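/- Let $\ell>0$ and $\tau>0$ be real numbers. Then there exist $\epsilon\in(0,1)$, a function $\psi$ that is $C^\infty$ on the disc $$B=\{(r,z)\in\mathbb R^2:\ (r-\ell)^2+z^2<\epsilon^2\ell^2\},$$ and functions $A,P,G,F:\mathbb R\to\mathbb R$ with the following properties. 1. $\psi(\ell,0)=0$, and $\psi>0$ on $B\setminus\{(\ell,0)\}$. 2. $A$, $P$ and $G$ are real analytic at every point of the range $\psi(B)$, and $F(s)^2=G(s)$ for every $s\in\psi(B)$; that is, $A$, $P$ and $F^2$ are real-analytic functions of $\psi$. 3. At every point $(r,z)\in B$, with classical derivatives, the Grad–Shafranov equation $$-\Big(\partial_r^2\psi-\tfrac1r\partial_r\psi+\partial_z^2\psi\Big)=\tfrac12 (F^2)'(\psi)+r^2P'(\psi)$$ (where $(F^2)'$ denotes $G'$) and the localizability constraint $$(\partial_r\psi)^2+(\partial_z\psi)^2+F(\psi)^2=2r^2A(\psi)$$ hold. 4. Let $(r,\phi,z)$ be cylindrical coordinates in $\mathbb R^3$ with orthonormal frame $e_r,e_\phi,e_z$ ($e_r\times e_\phi=e_z$), let $\Omega\subset\mathbb R^3$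 be the set of points with $(r,z)\in B$, and set on $\Omega$ $$u=\tfrac1r(\partial_z\psi)\,e_r-\tfrac1r(\partial_r\psi)\,e_z+\tfrac1rF(\psi)\,e_\phi,\qquad p=-P(\psi)-A(\psi).$$ Then $p=\dfrac{\psi}{\ell\tau}$ on $\Omega$; $u$ is Hölder continuous on $\Omega$ with some exponent in $(0,1]$; and $(u,p)$ solves the steady incompressible Euler equations $u\cdot\nabla u+\nabla p=0$, $\operatorname{div}u=0$ weakly in $\Omega$, that is, $$\int_\Omega\Big(\sum_{i,j}u_iu_j\,\partial_j\Phi_i+p\operatorname{div}\Phi\Big)dx=0,\qquad \int_\Omega u\cdot\nabla\eta\,dx=0$$ for all $\Phi\in C_c^\infty(\Omega;\mathbb R^3)$ and $\eta\in C_c^\infty(\Omega)$. 5. $u$ is differentiable almost everywhere in $\Omega$; its vorticity $\omega=\nabla\times u$, defined almost everywhere, is also the distributional curl of $u$ in $\Omega$ and belongs to $L^\infty(\Omega)$; and for almost every $x\in\Omega$ the function $\frac{|u|^2}{2}+p$ is differentiable at $x$ and $$\omega\times u+\nabla\Big(\frac{|u|^2}{2}+p\Big)=0 .$$ -/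

import Mathlib

open Set MeasureTheory
open scoped NNReal ContDiff

noncomputable section

namespace GradShafranov

/-! ### The meridional half-plane, with coordinates `(r, z)` -/

/-- The open Euclidean disc of radius `ε * ℓ` centred at `(r, z) = (ℓ, 0)`. -/
def disc (ℓ ε : ℝ) : Set (ℝ × ℝ) :=
  {q | (q.1 - ℓ) ^ 2 + q.2 ^ 2 < ε ^ 2 * ℓ ^ 2}

/-- The partial derivative in `r`. -/
def partialR (f : ℝ × ℝ → ℝ) (q : ℝ × ℝ) : ℝ := deriv (fun r => f (r, q.2)) q.1

/-- The partial derivative in `z`. -/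
def partialZ (f : ℝ × ℝ → ℝ) (q : ℝ × ℝ) : ℝ := deriv (fun z => f (q.1, z)) q.2

/-- The Grad-Shafranov operator `∂_r² ψ - (1/r) ∂_r ψ + ∂_z² ψ`. -/
def gsOperator (ψ : ℝ × ℝ → ℝ) (q : ℝ × ℝ) : ℝ :=
  partialR (partialR ψ) q - 1 / q.1 * partialR ψ q + partialZ (partialZ ψ) q

/-! ### Three-dimensional space and cylindrical coordinates about the third axis -/

/-- Euclidean three-space. -/
abbrev E3 : Type := EuclideanSpace ℝ (Fin 3)

/-- The distance `r` to the axis of symmetry. -/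
def cylR (x : E3) : ℝ := Real.sqrt (x 0 ^ 2 + x 1 ^ 2)

/-- The coordinates `(r, z)` of a point of space. -/
def cylRZ (x : E3) : ℝ × ℝ := (cylR x, x 2)

/-- The unit vector `e_r`. -/
def eR (x : E3) : E3 := !₂[x 0 / cylR x, x 1 / cylR x, 0]

/-- The unit vector `e_φ`. -/
def ePhi (x : E3) : E3 := !₂[-(x 1) / cylR x, x 0 / cylR x, 0]

/-- The unit vector `e_z`. -/
def eZ : E3 := !₂[0, 0, 1]

/-- The open subset of space swept out by rotating the disc about the axis. -/
def torus (ℓ ε : ℝ) : Set E3 := {x | cylRZ x ∈ disc ℓ ε}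

/-- The axisymmetric velocity
`u = (1/r) (∂_z ψ) e_r - (1/r) (∂_r ψ) e_z + (1/r) F(ψ) e_φ`. -/
def velocity (ψ : ℝ × ℝ → ℝ) (F : ℝ → ℝ) (x : E3) : E3 :=
  (1 / cylR x * partialZ ψ (cylRZ x)) • eR x
    - (1 / cylR x * partialR ψ (cylRZ x)) • eZ
    + (1 / cylR x * F (ψ (cylRZ x))) • ePhi x

/-! ### Vector calculus in space -/

/-- `∂_j v_i` at `x`. -/
def partialE (v : E3 → E3) (j i : Fin 3) (x : E3) : ℝ :=
  (fderiv ℝ v x (EuclideanSpace.single j 1)) i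

/-- The divergence of a vector field. -/
def divergence (v : E3 → E3) (x : E3) : ℝ := ∑ i, partialE v i i x

/-- The curl of a vector field. -/
def curl (v : E3 → E3) (x : E3) : E3 :=
  !₂[partialE v 1 2 x - partialE v 2 1 x,
     partialE v 2 0 x - partialE v 0 2 x,
     partialE v 0 1 x - partialE v 1 0 x]

/-- The cross product of two vectors. -/
def cross (a b : E3) : E3 := WithLp.toLp 2 (crossProduct a.ofLp b.ofLp)

/-- Smooth functions with compact support contained in `Ω`. -/
def IsTest {V : Type*} [NormedAddCommGroup V] [NormedSpace ℝ V]
    (Ω : Set E3) (Φ : E3 → V) : Prop :=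
  ContDiff ℝ ∞ Φ ∧ HasCompactSupport Φ ∧ tsupport Φ ⊆ Ω

/-- `div u = 0` in the sense of distributions on `Ω`. -/
def WeaklyDivergenceFree (u : E3 → E3) (Ω : Set E3) : Prop :=
  ∀ η : E3 → ℝ, IsTest Ω η → ∫ x in Ω, fderiv ℝ η x (u x) = 0

/-- The momentum equation `u · ∇u + ∇p = 0`, that is `div (u ⊗ u) + ∇p = 0`,
in the sense of distributions on `Ω`:
`∫ (∑ i j, u_i u_j ∂_j Φ_i + p div Φ) = 0` for all test fields `Φ`. -/
def WeakMomentum (u : E3 → E3) (p : E3 → ℝ) (Ω : Set E3) : Prop :=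
  ∀ Φ : E3 → E3, IsTest Ω Φ →
    ∫ x in Ω, (inner ℝ (u x) (fderiv ℝ Φ x (u x)) + p x * divergence Φ x) = 0

/-- `(u, p)` is a weak solution of the steady incompressible Euler equations in `Ω`. -/
def IsWeakEuler (u : E3 → E3) (p : E3 → ℝ) (Ω : Set E3) : Prop :=
  WeakMomentum u p Ω ∧ WeaklyDivergenceFree u Ω

/-- `w` is the curl of `u` in the sense of distributions on `Ω`. -/
def IsWeakCurl (w u : E3 → E3) (Ω : Set E3) : Prop :=
  ∀ Φ : E3 → E3, IsTest Ω Φ →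
    ∫ x in Ω, inner ℝ (w x) (Φ x) = ∫ x in Ω, inner ℝ (u x) (curl Φ x)

end GradShafranov

end

noncomputable section

namespace GradShafranov

open Filter Topology

/-! ### Real power series converging on the unit interval -/

/-! Put k = 1/(2ℓτ), A(s) = 3ks and P(s) = -5ks, so that the pressure is 2kψ = ψ/(ℓτ). The key
ansatz is ψ_r = r(kr² + c(ψ)) with an unknown function c. The localizability constraint then
expresses ψ_z² through r and ψ (`axialSq`), differentiation in z gives ψ_zz (`axialSecond`), and the
Grad–Shafranov equation becomes an identity (`IsVortexCore.gradShafranov`).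

Prescribing both ψ_r and ψ_z² is overdetermined. Since ψ_rz = r c'(ψ) ψ_z, compatibility means
∂_r(ψ_z²) = 2r c'(ψ) ψ_z². The discrepancy is a combination of r and r³ whose two coefficients give
ordinary differential equations for c and G = F² (`IsProfilePair`). Eliminating G and passing to the
inverse function of c (up to affine scaling) leaves (m²)'' = 6m + 4(1 - t)m' with m(0) = 0. This
equation is singular at 0, but has a power series solution with summable coefficients
(`sum_abs_profileCoeff_le_one`, `exists_isProfilePair`).

Given c and G, ψ is found on the line r = ℓ from a second-order equation and then transported along
the radial one; compatibility propagates the formula for ψ_z² (`exists_isStreamPair`). At the centre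
the Hessian of ψ is 2kℓ² times the identity, whence positivity (`IsStreamPair.exists_pos`).

The only loss of smoothness is in F = √G at ψ = 0. There |∇ψ|² ≤ 6kr²ψ while G(ψ) ≥ kℓ²ψ, so ∇√G(ψ)
stays bounded and F(ψ) is Lipschitz (`IsStreamPair.boundedLipschitzOn_sqrt`). Hence u is Lipschitz,
it solves the Euler equations classically off the null circle r = ℓ, z = 0
(`IsVortexCore.euler_at`), and integration by parts for Lipschitz functions
(`BoundedLipschitzOn.integral_mul_fderiv`) gives the weak statements. -/

/-- The sum of the power series with coefficients `a`. -/
def powerSum (a : ℕ → ℝ) (t : ℝ) : ℝ := ∑' n, a n * t ^ n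

/-- Absolute convergence of the power series with coefficients `a` on the open unit interval. -/
def ConvergesOnUnit (a : ℕ → ℝ) : Prop :=
  ∀ ρ : ℝ, 0 ≤ ρ → ρ < 1 → Summable fun n => |a n| * ρ ^ n

/-- The coefficients of the derivative of a power series. -/
def derivCoeff (a : ℕ → ℝ) (n : ℕ) : ℝ := (n + 1) * a (n + 1)

/-- The coefficients of the square of a power series. -/
def sqCoeff (a : ℕ → ℝ) (n : ℕ) : ℝ := ∑ p ∈ Finset.HasAntidiagonal.antidiagonal n, a p.1 * a p.2

theorem ConvergesOnUnit.summable {a : ℕ → ℝ} (ha : ConvergesOnUnit a) {t : ℝ} (ht : |t| < 1) :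
    Summable fun n => a n * t ^ n := by
  refine Summable.of_norm ?_
  simpa [abs_mul, abs_pow] using ha |t| (abs_nonneg t) ht

/-- For ρ < σ < 1 the factor n ρ^(n-1) is eventually at most σ^n/ρ, so differentiating termwise
costs no radius of convergence. -/
theorem ConvergesOnUnit.summable_weighted {a : ℕ → ℝ} (ha : ConvergesOnUnit a) {ρ : ℝ}
    (h0 : 0 < ρ) (h1 : ρ < 1) : Summable fun n : ℕ => (n : ℝ) * |a n| * ρ ^ (n - 1) := by
  obtain ⟨σ, hσ1, hσ2⟩ := exists_between h1
  have hσ0 : 0 < σ := h0.trans hσ1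
  have hq : |ρ / σ| < 1 := by
    rw [abs_of_pos (div_pos h0 hσ0), div_lt_one hσ0]; exact hσ1
  have hlim : Tendsto (fun n : ℕ => (n : ℝ) * (ρ / σ) ^ n) atTop (𝓝 0) :=
    tendsto_self_mul_const_pow_of_abs_lt_one hq
  have hbd : ∀ᶠ n : ℕ in atTop, (n : ℝ) * (ρ / σ) ^ n ≤ 1 :=
    hlim.eventually (Iic_mem_nhds one_pos) |>.mono fun n hn => hn
  refine Summable.of_norm_bounded_eventually_nat ((ha σ hσ0.le hσ2).mul_left ρ⁻¹) ?_
  filter_upwards [hbd] with n hn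
  rcases Nat.eq_zero_or_pos n with rfl | hpos
  · simp; positivity
  · have e : ρ ^ n = ρ * ρ ^ (n - 1) := by
      rw [← pow_succ']; congr 1; omega
    rw [Real.norm_of_nonneg (by positivity)]
    have h2 : (n : ℝ) * ρ ^ n ≤ σ ^ n := by
      rw [div_pow, ← mul_div_assoc, div_le_one (by positivity)] at hn
      exact hn
    have h3 : (n : ℝ) * ρ ^ (n - 1) ≤ ρ⁻¹ * σ ^ n := by
      rw [inv_mul_eq_div, le_div_iff₀ h0]
      calc (n : ℝ) * ρ ^ (n - 1) * ρ = n * ρ ^ n := by rw [e]; ring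
        _ ≤ _ := h2
    calc (n : ℝ) * |a n| * ρ ^ (n - 1) = |a n| * (n * ρ ^ (n - 1)) := by ring
      _ ≤ |a n| * (ρ⁻¹ * σ ^ n) := by gcongr
      _ = _ := by ring

theorem ConvergesOnUnit.derivCoeff {a : ℕ → ℝ} (ha : ConvergesOnUnit a) :
    ConvergesOnUnit (derivCoeff a) := by
  intro ρ h0 h1
  rcases h0.eq_or_lt with rfl | h0
  · refine summable_of_ne_finset_zero (s := {0}) fun n hn => ?_
    simp only [Finset.mem_singleton] at hn
    simp [hn]
  have := (summable_nat_add_iff 1).mpr (ha.summable_weighted h0 h1)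
  refine this.congr fun n => ?_
  simp only [GradShafranov.derivCoeff, abs_mul, Nat.add_sub_cancel]
  rw [abs_of_nonneg (by positivity : (0 : ℝ) ≤ (n : ℝ) + 1)]
  push_cast; ring

theorem hasDerivAt_powerSum {a : ℕ → ℝ} (ha : ConvergesOnUnit a) {t : ℝ} (ht : |t| < 1) :
    HasDerivAt (powerSum a) (powerSum (derivCoeff a) t) t := by
  obtain ⟨ρ, h1, h2⟩ := exists_between ht
  have h0 : 0 < ρ := (abs_nonneg t).trans_lt h1
  have key := hasDerivAt_tsum_of_isPreconnected (t := Ioo (-ρ) ρ) (y₀ := 0)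
    (g := fun n t => a n * t ^ n) (g' := fun n t => a n * (n * t ^ (n - 1)))
    (ha.summable_weighted h0 h2) isOpen_Ioo isPreconnected_Ioo
    (fun n y _ => (hasDerivAt_pow n y).const_mul (a n))
    (fun n y hy => by
      have hy' : |y| ≤ ρ := (abs_lt.mpr hy).le
      rw [Real.norm_eq_abs, abs_mul, abs_mul, abs_pow, Nat.abs_cast]
      calc |a n| * (n * |y| ^ (n - 1)) ≤ |a n| * (n * ρ ^ (n - 1)) := by gcongr
        _ = _ := by ring)
    ⟨by linarith, h0⟩ (ha.summable (by simp)) (abs_lt.mp h1)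
  refine key.congr_deriv ?_
  have hs : Summable fun n : ℕ => a n * (n * t ^ (n - 1)) := by
    refine Summable.of_norm_bounded (ha.summable_weighted h0 h2) fun n => ?_
    rw [Real.norm_eq_abs, abs_mul, abs_mul, abs_pow, Nat.abs_cast]
    calc |a n| * (n * |t| ^ (n - 1)) ≤ |a n| * (n * ρ ^ (n - 1)) := by gcongr
      _ = _ := by ring
  rw [hs.tsum_eq_zero_add]
  simp only [powerSum, derivCoeff, Nat.cast_zero, zero_mul, mul_zero, zero_add]
  refine tsum_congr fun n => ?_
  push_cast
  ring

theorem ConvergesOnUnit.sqCoeff {a : ℕ → ℝ} (ha : ConvergesOnUnit a) :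
    ConvergesOnUnit (sqCoeff a) := by
  intro ρ h0 h1
  have hs : Summable fun n => ‖a n * ρ ^ n‖ := by
    simpa [abs_mul, abs_pow, abs_of_nonneg h0] using ha ρ h0 h1
  refine (summable_norm_sum_mul_antidiagonal_of_summable_norm hs hs).congr fun n => ?_
  rw [Real.norm_eq_abs, ← abs_of_nonneg (pow_nonneg h0 n), ← abs_mul,
    GradShafranov.sqCoeff, Finset.sum_mul]
  congr 1
  refine Finset.sum_congr rfl fun p hp => ?_
  rw [← Finset.HasAntidiagonal.mem_antidiagonal.mp hp, pow_add]; ring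

theorem powerSum_sq {a : ℕ → ℝ} (ha : ConvergesOnUnit a) {t : ℝ} (ht : |t| < 1) :
    powerSum a t ^ 2 = powerSum (sqCoeff a) t := by
  have hs : Summable fun n => ‖a n * t ^ n‖ := by
    simpa [abs_mul, abs_pow] using ha |t| (abs_nonneg t) ht
  rw [sq, powerSum, tsum_mul_tsum_eq_tsum_sum_antidiagonal_of_summable_norm hs hs, powerSum]
  refine tsum_congr fun n => ?_
  rw [sqCoeff, Finset.sum_mul]
  refine Finset.sum_congr rfl fun p hp => ?_
  rw [← Finset.HasAntidiagonal.mem_antidiagonal.mp hp, pow_add]; ring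

theorem powerSum_zero (a : ℕ → ℝ) : powerSum a 0 = a 0 := by
  rw [powerSum, tsum_eq_single 0 (fun n hn => by simp [hn])]; simp

theorem analyticAt_powerSum {a : ℕ → ℝ} (ha : ConvergesOnUnit a) :
    AnalyticAt ℝ (powerSum a) 0 := by
  set p := FormalMultilinearSeries.ofScalars ℝ a
  have hr : ((1 / 2 : ℝ≥0) : ENNReal) ≤ p.radius := by
    refine p.le_radius_of_summable_norm ?_
    simpa [p, FormalMultilinearSeries.ofScalars_norm] using ha (1 / 2) (by norm_num) (by norm_num)
  have hp : 0 < p.radius := lt_of_lt_of_le (by norm_num) hr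
  have h := (p.hasFPowerSeriesOnBall hp).analyticAt
  refine h.congr (Eventually.of_forall fun t => ?_)
  have : p.sum = FormalMultilinearSeries.ofScalarsSum a := rfl
  rw [this, FormalMultilinearSeries.ofScalars_sum_eq]
  simp [powerSum]

/-! ### The profile: a power series solution of `(m²)'' = 6 m + 4 (1 - t) m'` -/

/-- The coefficient of `t ^ (N + 1)` in the profile. -/
def profileCoeff : ℕ → ℝ
  -- The constant term of the equation reads 2a² = 4a, and 2 is the nonzero root. In degree N + 1
  -- the top unknown enters with 4(N+2)(N+3) from (m²)'' and 4(N+2) from 4m'; the net factor 4(N+2)²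
  -- never vanishes.
  | 0 => 2
  | N + 1 => ((10 - 4 * ((N : ℝ) + 2)) * profileCoeff N
      - ((N : ℝ) + 2) * (N + 3)
        * ∑ i : Fin N, profileCoeff (i + 1) * profileCoeff (N - i)) / (4 * ((N : ℝ) + 2) ^ 2)
  decreasing_by all_goals omega

theorem profileCoeff_zero : profileCoeff 0 = 2 := by rw [profileCoeff]

theorem profileCoeff_succ (N : ℕ) :
    4 * ((N : ℝ) + 2) ^ 2 * profileCoeff (N + 1) = (10 - 4 * ((N : ℝ) + 2)) * profileCoeff N
      - ((N : ℝ) + 2) * (N + 3)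
        * ∑ i ∈ Finset.range N, profileCoeff (i + 1) * profileCoeff (N - i) := by
  rw [profileCoeff, mul_div_cancel₀ _ (by positivity),
    Finset.sum_range fun i => profileCoeff (i + 1) * profileCoeff (N - i)]

/-- After division by 4(N+2)² both multipliers are largest at N = 0, where 1/8 and 3/8 are attained.
-/
theorem abs_profileCoeff_succ_le (N : ℕ) :
    |profileCoeff (N + 1)| ≤ 1 / 8 * |profileCoeff N|
      + 3 / 8 * ∑ i ∈ Finset.range N, |profileCoeff (i + 1)| * |profileCoeff (N - i)| := by
  have h := profileCoeff_succ N
  set S := ∑ i ∈ Finset.range N, profileCoeff (i + 1) * profileCoeff (N - i) with hS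
  have hSle : |S| ≤ ∑ i ∈ Finset.range N, |profileCoeff (i + 1)| * |profileCoeff (N - i)| := by
    refine (Finset.abs_sum_le_sum_abs _ _).trans (le_of_eq ?_)
    exact Finset.sum_congr rfl fun i _ => abs_mul _ _
  have hN : (0 : ℝ) ≤ N := N.cast_nonneg
  have hpos : 0 < 4 * ((N : ℝ) + 2) ^ 2 := by positivity
  have h1 : |10 - 4 * ((N : ℝ) + 2)| ≤ 1 / 8 * (4 * ((N : ℝ) + 2) ^ 2) := by
    rw [abs_le]; constructor <;> nlinarith [sq_nonneg ((N : ℝ) - 2)]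
  have h2 : ((N : ℝ) + 2) * (N + 3) ≤ 3 / 8 * (4 * ((N : ℝ) + 2) ^ 2) := by nlinarith
  refine le_of_mul_le_mul_left ?_ hpos
  calc 4 * ((N : ℝ) + 2) ^ 2 * |profileCoeff (N + 1)|
      = |4 * ((N : ℝ) + 2) ^ 2 * profileCoeff (N + 1)| := by
        rw [abs_mul, abs_of_pos hpos]
    _ ≤ |10 - 4 * ((N : ℝ) + 2)| * |profileCoeff N| + ((N : ℝ) + 2) * (N + 3) * |S| := by
        rw [h]
        refine (abs_sub _ _).trans (le_of_eq ?_)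
        rw [abs_mul, abs_mul, abs_of_nonneg (by positivity : 0 ≤ ((N : ℝ) + 2) * (N + 3))]
    _ ≤ 1 / 8 * (4 * ((N : ℝ) + 2) ^ 2) * |profileCoeff N|
          + 3 / 8 * (4 * ((N : ℝ) + 2) ^ 2)
            * ∑ i ∈ Finset.range N, |profileCoeff (i + 1)| * |profileCoeff (N - i)| := by
        gcongr
    _ = _ := by ring

/-- The triangle i + j < N lies inside the square i, j < N. -/
theorem sum_range_sum_antidiagonal_le_sq {f : ℕ → ℝ} (hf : ∀ n, 0 ≤ f n) (N : ℕ) :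
    ∑ M ∈ Finset.range N, ∑ p ∈ Finset.HasAntidiagonal.antidiagonal M, f p.1 * f p.2
      ≤ (∑ i ∈ Finset.range N, f i) ^ 2 := by
  classical
  have hinj : Set.InjOn (fun x : (_ : ℕ) × (ℕ × ℕ) => x.2)
      ((Finset.range N).sigma fun M => Finset.HasAntidiagonal.antidiagonal M) := by
    rintro ⟨M, p⟩ hM ⟨M', p'⟩ hM' (rfl : p = p')
    simp only [Finset.coe_sigma, Set.mem_sigma_iff, Finset.mem_coe,
      Finset.HasAntidiagonal.mem_antidiagonal] at hM hM'
    obtain rfl : M = M' := hM.2.symm.trans hM'.2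
    rfl
  rw [sq, Finset.sum_mul_sum, ← Finset.sum_product', Finset.sum_sigma',
    ← Finset.sum_image (f := fun p : ℕ × ℕ => f p.1 * f p.2) hinj]
  refine Finset.sum_le_sum_of_subset_of_nonneg ?_ fun p _ _ => mul_nonneg (hf _) (hf _)
  rintro p hp
  simp only [Finset.mem_image, Finset.mem_sigma, Finset.mem_range, Sigma.exists,
    Finset.HasAntidiagonal.mem_antidiagonal] at hp
  obtain ⟨M, q, ⟨hM, hq⟩, rfl⟩ := hp
  simp only [Finset.mem_product, Finset.mem_range]
  omega

/-- Summing the recursive bound gives S ↦ (2 + S)/8 + 3S²/8 for the partial sums, and this maps [0,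
1] into itself. The 2 is the zeroth coefficient, which the sum leaves out. -/
theorem sum_abs_profileCoeff_le_one (N : ℕ) :
    ∑ i ∈ Finset.range N, |profileCoeff (i + 1)| ≤ 1 := by
  induction N with
  | zero => simp
  | succ N ih =>
    set S := ∑ i ∈ Finset.range N, |profileCoeff (i + 1)| with hS
    have hS0 : 0 ≤ S := Finset.sum_nonneg fun _ _ => abs_nonneg _
    have h1 : ∑ M ∈ Finset.range (N + 1), |profileCoeff M| = 2 + S := by
      rw [Finset.sum_range_succ', profileCoeff_zero]; norm_num; ring
    have h2 : ∑ M ∈ Finset.range (N + 1), ∑ i ∈ Finset.range M,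
        |profileCoeff (i + 1)| * |profileCoeff (M - i)| ≤ S ^ 2 := by
      rw [Finset.sum_range_succ']
      simp only [Finset.range_zero, Finset.sum_empty, add_zero]
      refine le_trans (le_of_eq ?_)
        (sum_range_sum_antidiagonal_le_sq (f := fun i => |profileCoeff (i + 1)|)
          (fun _ => abs_nonneg _) N)
      refine Finset.sum_congr rfl fun M _ => ?_
      rw [Finset.Nat.sum_antidiagonal_eq_sum_range_succ
        (fun i j => |profileCoeff (i + 1)| * |profileCoeff (j + 1)|)]
      refine Finset.sum_congr rfl fun i hi => ?_
      rw [Nat.sub_add_comm (Nat.lt_succ_iff.mp (Finset.mem_range.mp hi))]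
    calc ∑ M ∈ Finset.range (N + 1), |profileCoeff (M + 1)|
        ≤ ∑ M ∈ Finset.range (N + 1), (1 / 8 * |profileCoeff M| + 3 / 8 *
            ∑ i ∈ Finset.range M, |profileCoeff (i + 1)| * |profileCoeff (M - i)|) :=
          Finset.sum_le_sum fun M _ => abs_profileCoeff_succ_le M
      _ ≤ 1 / 8 * (2 + S) + 3 / 8 * S ^ 2 := by
          rw [Finset.sum_add_distrib, ← Finset.mul_sum, ← Finset.mul_sum, h1]
          gcongr
      _ ≤ 1 := by nlinarith

/-- The coefficients of the profile. -/
def profileSeries : ℕ → ℝ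
  | 0 => 0
  | N + 1 => profileCoeff N

theorem convergesOnUnit_profileSeries : ConvergesOnUnit profileSeries := by
  intro ρ h0 h1
  have hs : Summable fun n => |profileSeries n| := by
    rw [← summable_nat_add_iff 2]
    exact summable_of_sum_range_le (fun _ => abs_nonneg _) sum_abs_profileCoeff_le_one
  refine Summable.of_nonneg_of_le (fun n => by positivity) (fun n => ?_) hs
  exact mul_le_of_le_one_right (abs_nonneg _) (pow_le_one₀ h0 h1.le)

/-- The coefficient of t^n in (m²)'' = 6m + 4m' - 4tm'. Since m has no constant term, m² starts in
degree 2, which accounts for the index shifts. -/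
theorem profileSeries_recursion (n : ℕ) :
    derivCoeff (derivCoeff (sqCoeff profileSeries)) n
      = 6 * profileSeries n + 4 * derivCoeff profileSeries n - 4 * (n * profileSeries n) := by
  have hsq : ∀ N, sqCoeff profileSeries (N + 2)
      = ∑ p ∈ Finset.range (N + 1), profileCoeff p * profileCoeff (N - p) := by
    intro N
    rw [sqCoeff, Finset.Nat.sum_antidiagonal_eq_sum_range_succ
      (fun i j => profileSeries i * profileSeries j), Finset.sum_range_succ,
      Finset.sum_range_succ']
    simp only [profileSeries, zero_mul, add_zero, Nat.sub_self, mul_zero]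
    refine Finset.sum_congr rfl fun p hp => ?_
    have : N + 2 - (p + 1) = (N - p) + 1 := by
      have := Finset.mem_range.mp hp; omega
    rw [this]
  rcases n with _ | N
  · simp only [derivCoeff, zero_add, hsq 0]
    simp [profileSeries, profileCoeff_zero]; norm_num
  · have h := profileCoeff_succ N
    simp only [derivCoeff]
    rw [show N + 1 + 1 + 1 = (N + 1) + 2 from rfl, hsq (N + 1), Finset.sum_range_succ,
      Finset.sum_range_succ']
    simp only [profileSeries, Nat.sub_self, profileCoeff_zero, Nat.sub_zero,
      Nat.add_sub_add_right]
    push_cast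
    linear_combination h

/-- The profile `m`. -/
def profile : ℝ → ℝ := powerSum profileSeries

/-- The derivative of the profile. -/
def profile' : ℝ → ℝ := powerSum (derivCoeff profileSeries)

theorem profile_zero : profile 0 = 0 := powerSum_zero _

theorem profile'_zero : profile' 0 = 2 := by
  rw [profile', powerSum_zero]; simp [derivCoeff, profileSeries, profileCoeff_zero]

theorem analyticAt_profile : AnalyticAt ℝ profile 0 :=
  analyticAt_powerSum convergesOnUnit_profileSeries

theorem analyticAt_profile' : AnalyticAt ℝ profile' 0 :=
  analyticAt_powerSum convergesOnUnit_profileSeries.derivCoeff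

theorem hasDerivAt_profile {t : ℝ} (ht : |t| < 1) : HasDerivAt profile (profile' t) t :=
  hasDerivAt_powerSum convergesOnUnit_profileSeries ht

/-- Half of the profile equation, because m m' = (m²)'/2. In this form it can be composed with an
inverse of m without naming m''. -/
theorem hasDerivAt_profile_mul_profile' {t : ℝ} (ht : |t| < 1) :
    HasDerivAt (fun t => profile t * profile' t)
      (3 * profile t + 2 * (1 - t) * profile' t) t := by
  have hm := convergesOnUnit_profileSeries
  have hnear : ∀ᶠ x in 𝓝 t, |x| < 1 := continuous_abs.continuousAt.eventually (gt_mem_nhds ht)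
  have h1 : ∀ x, |x| < 1 →
      profile x * profile' x = powerSum (derivCoeff (sqCoeff profileSeries)) x / 2 := by
    intro x hx
    have hn : ∀ᶠ y in 𝓝 x, |y| < 1 := continuous_abs.continuousAt.eventually (gt_mem_nhds hx)
    have e1 : HasDerivAt (fun y => profile y ^ 2) (2 * profile x * profile' x) x := by
      simpa using (hasDerivAt_profile hx).fun_pow 2
    have e2 := hasDerivAt_powerSum hm.sqCoeff hx
    have e3 : (fun y => profile y ^ 2) =ᶠ[𝓝 x] powerSum (sqCoeff profileSeries) :=
      hn.mono fun y hy => powerSum_sq hm hy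
    linarith [e1.unique (e2.congr_of_eventuallyEq e3)]
  have h2 := (hasDerivAt_powerSum hm.sqCoeff.derivCoeff ht).div_const 2
  refine (h2.congr_of_eventuallyEq (hnear.mono h1)).congr_deriv ?_
  have s1 := hm.summable ht
  have s2 := hm.derivCoeff.summable ht
  have s3 : Summable fun n : ℕ => (n * profileSeries n) * t ^ n := by
    rw [← summable_nat_add_iff 1]
    refine (s2.mul_left t).congr fun n => ?_
    simp only [derivCoeff]; push_cast; ring
  have e3 : ∑' n : ℕ, (n * profileSeries n) * t ^ n = t * profile' t := by
    rw [s3.tsum_eq_zero_add, profile', powerSum, ← tsum_mul_left]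
    simp only [Nat.cast_zero, zero_mul, zero_add]
    refine tsum_congr fun n => ?_
    simp only [derivCoeff]; push_cast; ring
  have e : powerSum (derivCoeff (derivCoeff (sqCoeff profileSeries))) t
      = 6 * profile t + 4 * profile' t - 4 * (t * profile' t) := by
    rw [← e3, profile, profile', powerSum, powerSum, powerSum, ← tsum_mul_left, ← tsum_mul_left,
      ← tsum_mul_left, ← (s1.mul_left 6).tsum_add (s2.mul_left 4),
      ← ((s1.mul_left 6).add (s2.mul_left 4)).tsum_sub (s3.mul_left 4)]
    refine tsum_congr fun n => ?_
    rw [profileSeries_recursion]; ring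
  rw [e]; ring

/-! ### The profiles `c` and `G` -/

/-- The identities satisfied by the profiles `c` and `G`, which make the overdetermined system
for the stream function compatible. -/
structure IsProfilePair (k ℓ : ℝ) (c G : ℝ → ℝ) : Prop where
  analyticAt_left : AnalyticAt ℝ c 0
  analyticAt_right : AnalyticAt ℝ G 0
  left_zero : c 0 = -(k * ℓ ^ 2)
  right_zero : G 0 = 0
  deriv_right : ∀ᶠ s in 𝓝 0, deriv G s = -2 * c s - 12 * s * deriv c s
  compat : ∀ᶠ s in 𝓝 0,
    12 * k * s - 2 * c s ^ 2 - deriv G s * c s = -2 * G s * deriv c s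

/-- Inserting G' = -2c - 12sc' into the second identity gives 12s(k + cc') = -2Gc', that is G =
-6s(c + k/c'). With c = -kℓ²(1 - R), where R inverts βm, the first identity turns into the profile
equation. Since m'(0) = 2, the analytic inverse exists near 0. -/
theorem exists_isProfilePair {k ℓ : ℝ} (hk : 0 < k) (hℓ : 0 < ℓ) :
    ∃ c G : ℝ → ℝ, IsProfilePair k ℓ c G := by
  have hd0 : HasStrictDerivAt profile 2 0 := by
    have := analyticAt_profile.hasStrictDerivAt
    rwa [(hasDerivAt_profile (t := 0) (by simp)).deriv, profile'_zero] at this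
  obtain ⟨T, hTa, hT0, hTinv⟩ : ∃ T : ℝ → ℝ, AnalyticAt ℝ T 0 ∧ T 0 = 0 ∧
      ∀ᶠ s in 𝓝 0, profile (T s) = s := by
    set hf := hd0.hasStrictFDerivAt_equiv two_ne_zero
    set e := hf.toOpenPartialHomeomorph profile
    have he : ⇑e = profile := hf.toOpenPartialHomeomorph_coe
    have hmem : (0 : ℝ) ∈ e.source := hf.mem_toOpenPartialHomeomorph_source
    have he0 : e 0 = 0 := by rw [he, profile_zero]
    refine ⟨e.symm, ?_, ?_, ?_⟩
    · have := e.analyticAt_symm' (a := 0) hmem (he ▸ analyticAt_profile)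
        (by rw [he]; exact hf.hasFDerivAt.fderiv)
      rwa [he0] at this
    · conv_lhs => rw [← he0]
      exact e.left_inv hmem
    · have : e.target ∈ 𝓝 (0 : ℝ) :=
        e.open_target.mem_nhds (he0 ▸ e.map_source hmem)
      filter_upwards [this] with s hs
      have := e.right_inv hs
      rwa [he] at this
  -- The scale for which k and ℓ drop out of the equation for m.
  set β := k * ℓ ^ 4 / 3 with hβ
  have hβ0 : 0 < β := by positivity
  set R : ℝ → ℝ := fun s => T (s / β)
  have hdiv : AnalyticAt ℝ (fun s : ℝ => s / β) 0 := by fun_prop (disch := positivity)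
  have hRa : AnalyticAt ℝ R 0 := AnalyticAt.fun_comp (by simpa using hTa) hdiv
  have hR0 : R 0 = 0 := by simp [R, hT0]
  have hm'a : AnalyticAt ℝ (fun s => profile' (R s)) 0 :=
    AnalyticAt.fun_comp (by simpa [hR0] using analyticAt_profile') hRa
  have hev : ∀ᶠ s in 𝓝 0, β * profile (R s) = s ∧ |R s| < 1 ∧ 0 < profile' (R s) ∧
      DifferentiableAt ℝ R s ∧ DifferentiableAt ℝ (fun s => profile' (R s)) s := by
    have h1 : ∀ᶠ s in 𝓝 0, profile (R s) = s / β := by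
      have : Tendsto (fun s : ℝ => s / β) (𝓝 0) (𝓝 0) := by
        simpa using hdiv.continuousAt.tendsto
      exact this.eventually hTinv
    have h2 : ∀ᶠ s in 𝓝 0, |R s| < 1 :=
      hRa.continuousAt.abs.eventually (gt_mem_nhds (by simp [hR0]))
    have h3 : ∀ᶠ s in 𝓝 0, 0 < profile' (R s) :=
      hm'a.continuousAt.eventually (lt_mem_nhds (by simp [hR0, profile'_zero]))
    filter_upwards [h1, h2, h3, hRa.eventually_analyticAt, hm'a.eventually_analyticAt]
      with s h1 h2 h3 h4 h5
    exact ⟨by rw [h1]; field_simp, h2, h3, h4.differentiableAt, h5.differentiableAt⟩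
  -- Here n stands for the s-derivative of m'(R(s)); as R' = 1/(βm'), the last identity is the
  -- profile equation divided by m'.
  have hders : ∀ᶠ s in 𝓝 0, β * profile (R s) = s ∧ 0 < profile' (R s) ∧
      HasDerivAt R (1 / (β * profile' (R s))) s ∧
      ∃ n, HasDerivAt (fun s => profile' (R s)) n s ∧
        β * (profile (R s) * n) + profile' (R s)
          = (3 * profile (R s) + 2 * (1 - R s) * profile' (R s)) / profile' (R s) := by
    filter_upwards [hev.eventually_nhds] with s hs
    obtain ⟨h1, h2, h3, h4, h5⟩ := hs.self_of_nhds
    have hR' : HasDerivAt R (1 / (β * profile' (R s))) s := by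
      have e1 : HasDerivAt (fun s => β * profile (R s)) (β * (profile' (R s) * deriv R s)) s :=
        ((hasDerivAt_profile h2).comp s h4.hasDerivAt).const_mul β
      have e2 : HasDerivAt (fun s => β * profile (R s)) 1 s :=
        (hasDerivAt_id s).congr_of_eventuallyEq (hs.mono fun x hx => hx.1)
      have := e1.unique e2
      have e3 : deriv R s = 1 / (β * profile' (R s)) := by
        rw [eq_div_iff (by positivity)]; linarith
      rw [← e3]; exact h4.hasDerivAt
    refine ⟨h1, h3, hR', _, h5.hasDerivAt, ?_⟩
    have e1 := ((hasDerivAt_profile h2).comp s hR').mul h5.hasDerivAt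
    have e2 := (hasDerivAt_profile_mul_profile' h2).comp s hR'
    have := e1.unique e2
    simp only [Function.comp] at this
    have h3' := h3.ne'
    field_simp at this ⊢
    linarith
  set c : ℝ → ℝ := fun s => -(k * ℓ ^ 2) * (1 - R s) with hc
  set G : ℝ → ℝ := fun s => 6 * k * ℓ ^ 2 * (s * (1 - R s - profile' (R s) / 3)) with hG
  refine ⟨c, G, ?_, ?_, by simp [hc, hR0], by simp [hG], ?_, ?_⟩
  · exact analyticAt_const.mul (analyticAt_const.sub hRa)
  · exact analyticAt_const.mul (analyticAt_id.mul
      ((analyticAt_const.sub hRa).sub (hm'a.div_const)))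
  all_goals
    filter_upwards [hders] with s hs
    obtain ⟨h1, h3, hR', n, hn, hnn⟩ := hs
    have dc : HasDerivAt c (-(k * ℓ ^ 2) * (0 - 1 / (β * profile' (R s)))) s :=
      ((hasDerivAt_const s (1 : ℝ)).sub hR').const_mul _
    have dG : HasDerivAt G (6 * k * ℓ ^ 2 * (1 * (1 - R s - profile' (R s) / 3)
        + s * (0 - 1 / (β * profile' (R s)) - n / 3))) s :=
      ((hasDerivAt_id s).mul (((hasDerivAt_const s (1 : ℝ)).sub hR').sub
        (hn.div_const 3))).const_mul _
    rw [dc.deriv, dG.deriv]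
    have h3' := h3.ne'
    have hs' : s = k * ℓ ^ 4 / 3 * profile (R s) := h1.symm
    simp only [hc, hG]
    generalize profile' (R s) = q at *
    generalize profile (R s) = m at *
    generalize R s = ρ at *
    have hn' : β * (m * n) = (3 * m + 2 * (1 - ρ) * q) / q - q := by linarith
    have hn3 : s * n = (3 * m + 2 * (1 - ρ) * q) / q - q := by rw [← hn', ← h1]; ring
    have hsplit : s * (0 - 1 / (β * q) - n / 3) = -(s / (β * q)) - (s * n) / 3 := by ring
    rw [hsplit, hn3, ← h1]
    simp only [hβ]
    field_simp
    ring

/-! ### Auxiliary facts on ordinary differential equations -/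

/-- Truncation of a real number to `[-η, η]` around `x`. -/
theorem exists_continuous_retraction_Icc (x : ℝ) {η : ℝ} (hη : 0 < η) :
    ∃ π : ℝ → ℝ, Continuous π ∧ (∀ t, π t ∈ Icc (x - η) (x + η)) ∧
      ∀ t ∈ Icc (x - η) (x + η), π t = t := by
  have h : x - η ≤ x + η := by linarith
  exact ⟨fun t => projIcc _ _ h t, continuous_subtype_val.comp continuous_projIcc,
    fun t => (projIcc _ _ h t).2, fun t ht => by simp only [projIcc_of_mem h ht]⟩

theorem _root_.HasDerivAt.comp_fst {f : ℝ → ℝ × ℝ} {f' : ℝ × ℝ} {t : ℝ} (h : HasDerivAt f f' t) :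
    HasDerivAt (fun t => (f t).1) f'.1 t := by
  exact (ContinuousLinearMap.fst ℝ ℝ ℝ).hasFDerivAt.comp_hasDerivAt t h

theorem _root_.HasDerivAt.comp_snd {f : ℝ → ℝ × ℝ} {f' : ℝ × ℝ} {t : ℝ} (h : HasDerivAt f f' t) :
    HasDerivAt (fun t => (f t).2) f'.2 t := by
  exact (ContinuousLinearMap.snd ℝ ℝ ℝ).hasFDerivAt.comp_hasDerivAt t h

/-- Local flow of a scalar non-autonomous equation, continuous in time and initial value. -/
theorem exists_scalar_flow {f : ℝ × ℝ → ℝ} {ℓ : ℝ} (hf : ContDiffAt ℝ 1 f (ℓ, 0)) :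
    ∃ η > 0, ∃ S : ℝ × ℝ → ℝ, Continuous S ∧ (∀ a, |a| ≤ η → S (ℓ, a) = a) ∧
      ∀ a r, |a| ≤ η → |r - ℓ| < η → HasDerivAt (fun r => S (r, a)) (f (r, S (r, a))) r := by
  -- Time becomes a state variable with speed 1, so the autonomous existence theorem applies; `hfst`
  -- later identifies this component with the time.
  have hF : ContDiffAt ℝ 1 (fun q : ℝ × ℝ => ((1 : ℝ), f q)) (ℓ, 0) := contDiffAt_const.prodMk hf
  obtain ⟨ε, hε, a₀, ρ, L, K, hρ, hpl⟩ := IsPicardLindelof.of_contDiffAt_one hF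
  obtain ⟨α, hα, hαc⟩ :=
    (hpl ℓ).exists_forall_mem_closedBall_eq_hasDerivWithinAt_continuousOn
  have hρ' : (0 : ℝ) < ρ := hρ
  obtain ⟨π₁, hπ₁, hπ₁m, hπ₁e⟩ := exists_continuous_retraction_Icc ℓ hε
  obtain ⟨π₂, hπ₂, hπ₂m, hπ₂e⟩ := exists_continuous_retraction_Icc 0 hρ'
  have hball : ∀ a, |a| ≤ (ρ : ℝ) → (ℓ, a) ∈ Metric.closedBall (ℓ, (0 : ℝ)) ρ := by
    intro a ha
    simpa [Prod.dist_eq] using ha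
  have hder : ∀ a, |a| ≤ (ρ : ℝ) → ∀ t ∈ Ioo (ℓ - ε) (ℓ + ε),
      HasDerivAt (fun t => α ((ℓ, a), t)) (1, f (α ((ℓ, a), t))) t := fun a ha t ht =>
    ((hα _ (hball a ha)).2 t (Ioo_subset_Icc_self ht)).hasDerivAt (Icc_mem_nhds ht.1 ht.2)
  have hfst : ∀ a, |a| ≤ (ρ : ℝ) → ∀ t ∈ Ioo (ℓ - ε) (ℓ + ε), (α ((ℓ, a), t)).1 = t := by
    intro a ha t ht
    have hd : ∀ x ∈ Ioo (ℓ - ε) (ℓ + ε),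
        HasDerivAt (fun t => (α ((ℓ, a), t)).1 - t) 0 x := fun x hx => by
      simpa using (hder a ha x hx).comp_fst.fun_sub (hasDerivAt_id x)
    have := isOpen_Ioo.is_const_of_deriv_eq_zero (isPreconnected_Ioo)
      (fun x hx => (hd x hx).differentiableAt.differentiableWithinAt)
      (fun x hx => (hd x hx).deriv) ht (⟨by linarith, by linarith⟩ : ℓ ∈ Ioo (ℓ - ε) (ℓ + ε))
    have h0 : α ((ℓ, a), ℓ) = (ℓ, a) := (hα _ (hball a ha)).1
    simp only [h0, sub_self] at this
    linarith
  -- Clamping both arguments makes the flow globally continuous without changing it near the base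
  -- point.
  refine ⟨min ε ρ, lt_min hε hρ', fun q => (α ((ℓ, π₂ q.2), π₁ q.1)).2, ?_, ?_, ?_⟩
  · refine continuous_snd.comp (hαc.comp_continuous (by fun_prop) fun q => ⟨?_, hπ₁m _⟩)
    refine hball _ ?_
    have := hπ₂m q.2
    rw [zero_sub, zero_add] at this
    exact abs_le.mpr this
  · intro a ha
    have ha' := ha.trans (min_le_right _ _)
    have h2 : π₂ a = a := hπ₂e a (by rw [zero_sub, zero_add]; exact abs_le.mp ha')
    have h1 : π₁ ℓ = ℓ := hπ₁e ℓ ⟨by linarith, by linarith⟩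
    have h0 : α ((ℓ, a), ℓ) = (ℓ, a) := (hα _ (hball a ha')).1
    simp only [h1, h2, h0]
  · intro a r ha hr
    have ha' := ha.trans (min_le_right _ _)
    have h2 : π₂ a = a := hπ₂e a (by rw [zero_sub, zero_add]; exact abs_le.mp ha')
    have hr' := abs_lt.mp (hr.trans_le (min_le_left _ _))
    have hrI : r ∈ Ioo (ℓ - ε) (ℓ + ε) := ⟨by linarith, by linarith⟩
    have h1 : π₁ r = r := hπ₁e r (Ioo_subset_Icc_self hrI)
    have hd := (hder a ha' r hrI).comp_snd
    have e : α ((ℓ, a), r) = (r, (α ((ℓ, a), r)).2) :=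
      Prod.ext (hfst a ha' r hrI) rfl
    simp only [h1, h2]
    rw [← e]
    refine hd.congr_of_eventuallyEq ?_
    filter_upwards [isOpen_Ioo.mem_nhds hrI] with x hx
    rw [hπ₁e x (Ioo_subset_Icc_self hx)]

/-- Local solution of `g'' = h (g)`, `g 0 = g' 0 = 0`. -/
theorem exists_second_order_solution {h : ℝ → ℝ} (hh : ContDiffAt ℝ 1 h 0) :
    ∃ η > 0, ∃ g g₁ : ℝ → ℝ, Continuous g ∧ Continuous g₁ ∧ g 0 = 0 ∧ g₁ 0 = 0 ∧
      ∀ z, |z| < η → HasDerivAt g (g₁ z) z ∧ HasDerivAt g₁ (h (g z)) z := by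
  have hF : ContDiffAt ℝ 1 (fun q : ℝ × ℝ => (q.2, h q.1)) ((0, 0) : ℝ × ℝ) :=
    contDiffAt_snd.prodMk (hh.fst')
  obtain ⟨α, hα0, ε, hε, hα⟩ :=
    hF.exists_forall_mem_closedBall_exists_eq_forall_mem_Ioo_hasDerivAt₀ 0
  rw [zero_sub, zero_add] at hα
  have hε2 : 0 < ε / 2 := by positivity
  obtain ⟨π, hπ, hπm, hπe⟩ := exists_continuous_retraction_Icc 0 hε2
  rw [zero_sub, zero_add] at hπm hπe
  have hin : ∀ z, π z ∈ Ioo (-ε) ε := fun z =>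
    ⟨by linarith [(hπm z).1], by linarith [(hπm z).2]⟩
  have hc : Continuous fun z => α (π z) :=
    ContinuousOn.comp_continuous (s := Ioo (-ε) ε)
      (fun z hz => (hα z hz).continuousAt.continuousWithinAt) hπ hin
  have h0 : π 0 = 0 := hπe 0 ⟨by linarith, by linarith⟩
  refine ⟨ε / 2, hε2, fun z => (α (π z)).1, fun z => (α (π z)).2, continuous_fst.comp hc,
    continuous_snd.comp hc, by simp [h0, hα0], by simp [h0, hα0], fun z hz => ?_⟩
  have hz' := abs_lt.mp hz
  have he : (fun z => α (π z)) =ᶠ[𝓝 z] α := by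
    filter_upwards [isOpen_Ioo.mem_nhds hz'] with x hx
    rw [hπe x (Ioo_subset_Icc_self hx)]
  have hd := (hα (π z) (hin z))
  rw [hπe z (Ioo_subset_Icc_self hz')] at hd
  have hd' := hd.congr_of_eventuallyEq he
  refine ⟨?_, ?_⟩
  · have := hd'.comp_fst
    simpa [hπe z (Ioo_subset_Icc_self hz')] using this
  · have := hd'.comp_snd
    simpa [hπe z (Ioo_subset_Icc_self hz')] using this

/-- Solutions of scalar linear equations. -/
theorem eq_mul_exp_integral {y a : ℝ → ℝ} {t₀ η : ℝ} (ha : Continuous a)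
    (hy : ∀ t, |t - t₀| < η → HasDerivAt y (a t * y t) t) {t : ℝ} (ht : |t - t₀| < η) :
    y t = y t₀ * Real.exp (∫ τ in t₀..t, a τ) := by
  have hI : ∀ t, HasDerivAt (fun t => ∫ τ in t₀..t, a τ) (a t) t := fun t =>
    (ha.integral_hasStrictDerivAt t₀ t).hasDerivAt
  have hd : ∀ t ∈ Metric.ball t₀ η,
      HasDerivAt (fun t => y t * Real.exp (-∫ τ in t₀..t, a τ)) 0 t := by
    intro t ht
    have := (hy t (by rwa [Metric.mem_ball, Real.dist_eq] at ht)).fun_mul ((hI t).fun_neg.exp)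
    refine this.congr_deriv ?_
    ring
  have hη : 0 < η := (abs_nonneg _).trans_lt ht
  have := Metric.isOpen_ball.is_const_of_deriv_eq_zero (convex_ball t₀ η).isPreconnected
    (fun x hx => (hd x hx).differentiableAt.differentiableWithinAt)
    (fun x hx => (hd x hx).deriv) (show t ∈ Metric.ball t₀ η by rwa [Metric.mem_ball, Real.dist_eq])
    (Metric.mem_ball_self hη)
  simp only [intervalIntegral.integral_same, neg_zero, Real.exp_zero, mul_one] at this
  rw [← this, mul_assoc, ← Real.exp_add]; simp

/-- A difference of solutions of an equation with a continuous factor is differentiable. -/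
theorem hasDerivAt_of_sub_eq_mul {f g K : ℝ → ℝ} {z g' : ℝ} (hg : HasDerivAt g g' z)
    (hK : ContinuousAt K z) (h : ∀ᶠ y in 𝓝 z, f y - f z = (g y - g z) * K y) :
    HasDerivAt f (g' * K z) z := by
  rw [hasDerivAt_iff_tendsto_slope] at hg ⊢
  refine Tendsto.congr' ?_ (hg.mul (hK.tendsto.mono_left nhdsWithin_le_nhds))
  filter_upwards [nhdsWithin_le_nhds h] with y hy
  rw [slope_def_field, slope_def_field, hy]; ring

/-- A continuous function that is nonzero at a point keeps its sign nearby, so it is a fixed branch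
±√v there. -/
theorem hasDerivAt_of_sq_eventuallyEq {w v : ℝ → ℝ} {z v' : ℝ} (hw : ContinuousAt w z)
    (h0 : w z ≠ 0) (hv : HasDerivAt v v' z) (h : ∀ᶠ y in 𝓝 z, w y ^ 2 = v y) :
    HasDerivAt w (v' / (2 * w z)) z := by
  have hz : w z ^ 2 = v z := h.self_of_nhds
  have hvz : v z ≠ 0 := by rw [← hz]; positivity
  have hs := hv.sqrt hvz
  rcases lt_or_gt_of_ne h0 with hneg | hpos
  · have e : w =ᶠ[𝓝 z] fun y => -√(v y) := by
      filter_upwards [h, hw.eventually (gt_mem_nhds hneg)] with y hy hy'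
      rw [← hy, Real.sqrt_sq_eq_abs, abs_of_neg hy', neg_neg]
    refine (hs.fun_neg.congr_of_eventuallyEq e).congr_deriv ?_
    rw [← hz, Real.sqrt_sq_eq_abs, abs_of_neg hneg]; ring
  · have e : w =ᶠ[𝓝 z] fun y => √(v y) := by
      filter_upwards [h, hw.eventually (lt_mem_nhds hpos)] with y hy hy'
      rw [← hy, Real.sqrt_sq_eq_abs, abs_of_pos hy']
    refine (hs.congr_of_eventuallyEq e).congr_deriv ?_
    rw [← hz, Real.sqrt_sq_eq_abs, abs_of_pos hpos]

/-- One-sided limits of the derivative give both one-sided derivatives. This covers the line z = 0,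
where ψ_z vanishes and dividing by it is impossible. -/
theorem hasDerivAt_of_eventually_hasDerivAt_of_ne {f g : ℝ → ℝ} {x : ℝ}
    (hd : ∀ᶠ y in 𝓝 x, y ≠ x → HasDerivAt f (g y) y) (hf : ContinuousAt f x)
    (hg : ContinuousAt g x) : HasDerivAt f (g x) x := by
  obtain ⟨ε, hε, hball⟩ := Metric.eventually_nhds_iff.mp hd
  have hright : Ioo x (x + ε) ∈ 𝓝[>] x := Ioo_mem_nhdsGT (by linarith)
  have hleft : Ioo (x - ε) x ∈ 𝓝[<] x := Ioo_mem_nhdsLT (by linarith)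
  have hdr : ∀ y ∈ Ioo x (x + ε), HasDerivAt f (g y) y := fun y hy =>
    hball (by rw [Real.dist_eq, abs_lt]; constructor <;> linarith [hy.1, hy.2]) hy.1.ne'
  have hdl : ∀ y ∈ Ioo (x - ε) x, HasDerivAt f (g y) y := fun y hy =>
    hball (by rw [Real.dist_eq, abs_lt]; constructor <;> linarith [hy.1, hy.2]) hy.2.ne
  have A : HasDerivWithinAt f (g x) (Ici x) x := by
    refine hasDerivWithinAt_Ici_of_tendsto_deriv
      (fun y hy => (hdr y hy).differentiableAt.differentiableWithinAt)
      hf.continuousWithinAt hright ?_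
    refine (hg.tendsto.mono_left nhdsWithin_le_nhds).congr' ?_
    filter_upwards [hright] with y hy using (hdr y hy).deriv.symm
  have B : HasDerivWithinAt f (g x) (Iic x) x := by
    refine hasDerivWithinAt_Iic_of_tendsto_deriv
      (fun y hy => (hdl y hy).differentiableAt.differentiableWithinAt)
      hf.continuousWithinAt hleft ?_
    refine (hg.tendsto.mono_left nhdsWithin_le_nhds).congr' ?_
    filter_upwards [hleft] with y hy using (hdl y hy).deriv.symm
  simpa using B.union A

/-- A function with continuous partial derivatives near a point is differentiable there. -/
theorem hasFDerivAt_of_partial {f a b : ℝ × ℝ → ℝ} {q : ℝ × ℝ}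
    (h₁ : ∀ᶠ p in 𝓝 q, HasDerivAt (fun r => f (r, p.2)) (a p) p.1)
    (h₂ : ∀ᶠ p in 𝓝 q, HasDerivAt (fun z => f (p.1, z)) (b p) p.2)
    (ha : ContinuousAt a q) (hb : ContinuousAt b q) :
    HasFDerivAt f (a q • ContinuousLinearMap.fst ℝ ℝ ℝ + b q • ContinuousLinearMap.snd ℝ ℝ ℝ)
      q := by
  have := hasStrictFDerivAt_uncurry_coprod (𝕜 := ℝ) (u := q) (f := fun r z => f (r, z))
    (f₁ := fun r z => a (r, z) • ContinuousLinearMap.id ℝ ℝ)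
    (f₂ := fun r z => b (r, z) • ContinuousLinearMap.id ℝ ℝ)
    (h₁.mono fun p hp => hp.hasFDerivAt.congr_fderiv
      (by ext; simp [Function.HasUncurry.uncurry]))
    (h₂.mono fun p hp => hp.hasFDerivAt.congr_fderiv
      (by ext; simp [Function.HasUncurry.uncurry]))
    (ha.smul continuousAt_const) (hb.smul continuousAt_const)
  refine this.hasFDerivAt.congr_fderiv ?_
  ext <;> simp [Function.HasUncurry.uncurry]

/-! ### The stream function -/

/-- `∂_r ψ` as a function of `r` and `ψ`. -/
def radialSlope (k : ℝ) (c : ℝ → ℝ) (q : ℝ × ℝ) : ℝ := q.1 * (k * q.1 ^ 2 + c q.2)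

/-- `(∂_z ψ) ^ 2` as a function of `r` and `ψ`. -/
def axialSq (k : ℝ) (c G : ℝ → ℝ) (q : ℝ × ℝ) : ℝ :=
  6 * k * q.1 ^ 2 * q.2 - G q.2 - radialSlope k c q ^ 2

/-- `∂_z² ψ` as a function of `r` and `ψ`: half the derivative of `axialSq` in `ψ`. -/
def axialSecond (k : ℝ) (c G : ℝ → ℝ) (q : ℝ × ℝ) : ℝ :=
  (6 * k * q.1 ^ 2 - deriv G q.2 - 2 * radialSlope k c q * (q.1 * deriv c q.2)) / 2

/-- `ψ` and `w = ∂_z ψ` solve the overdetermined first order system on `N`. -/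
structure IsStreamPair (k : ℝ) (c G : ℝ → ℝ) (δ : ℝ) (N : Set (ℝ × ℝ))
    (ψ w : ℝ × ℝ → ℝ) : Prop where
  abs_lt : ∀ q ∈ N, |ψ q| < δ
  hasFDerivAt_left : ∀ q ∈ N, HasFDerivAt ψ
    (radialSlope k c (q.1, ψ q) • ContinuousLinearMap.fst ℝ ℝ ℝ
      + w q • ContinuousLinearMap.snd ℝ ℝ ℝ) q
  hasFDerivAt_right : ∀ q ∈ N, HasFDerivAt w
    ((q.1 * deriv c (ψ q) * w q) • ContinuousLinearMap.fst ℝ ℝ ℝ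
      + axialSecond k c G (q.1, ψ q) • ContinuousLinearMap.snd ℝ ℝ ℝ) q
  sq_eq : ∀ q ∈ N, w q ^ 2 = axialSq k c G (q.1, ψ q)

/-- The compatibility condition of the overdetermined system: the two sides differ by multiples of
r³ and r, and the two profile identities kill these terms separately. -/
theorem hasDerivAt_axialSq_radial {k : ℝ} {c G y : ℝ → ℝ} {r : ℝ}
    (hc : DifferentiableAt ℝ c (y r)) (hG : DifferentiableAt ℝ G (y r))
    (hcompat : 12 * k * y r - 2 * c (y r) ^ 2 - deriv G (y r) * c (y r)
      = -2 * G (y r) * deriv c (y r))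
    (hd : deriv G (y r) = -2 * c (y r) - 12 * y r * deriv c (y r))
    (hy : HasDerivAt y (radialSlope k c (r, y r)) r) :
    HasDerivAt (fun r => axialSq k c G (r, y r))
      (2 * (r * deriv c (y r)) * axialSq k c G (r, y r)) r := by
  have hcy : HasDerivAt (fun r => c (y r)) _ r := hc.hasDerivAt.comp r hy
  have hGy : HasDerivAt (fun r => G (y r)) _ r := hG.hasDerivAt.comp r hy
  have hr : HasDerivAt (fun r : ℝ => r) 1 r := hasDerivAt_id r
  have hr2 : HasDerivAt (fun r : ℝ => r ^ 2) _ r := hr.fun_pow 2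
  have hU : HasDerivAt (fun r => radialSlope k c (r, y r)) _ r :=
    hr.fun_mul ((hr2.const_mul k).fun_add hcy)
  have := (((hr2.const_mul (6 * k)).fun_mul hy).fun_sub hGy).fun_sub (hU.fun_pow 2)
  refine this.congr_deriv ?_
  simp only [axialSq, radialSlope]
  norm_num
  linear_combination (-(r ^ 3 * k)) * hd + r * hcompat

theorem hasDerivAt_axialSq_axial {k : ℝ} {c G y : ℝ → ℝ} {r z y' : ℝ}
    (hc : DifferentiableAt ℝ c (y z)) (hG : DifferentiableAt ℝ G (y z))
    (hy : HasDerivAt y y' z) :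
    HasDerivAt (fun z => axialSq k c G (r, y z))
      (2 * axialSecond k c G (r, y z) * y') z := by
  have hcy : HasDerivAt (fun r => c (y r)) _ z := hc.hasDerivAt.comp z hy
  have hGy : HasDerivAt (fun r => G (y r)) _ z := hG.hasDerivAt.comp z hy
  have hU : HasDerivAt (fun z => radialSlope k c (r, y z)) _ z :=
    (hcy.const_add (k * r ^ 2)).const_mul r
  have := ((hy.const_mul (6 * k * r ^ 2)).fun_sub hGy).fun_sub (hU.fun_pow 2)
  refine this.congr_deriv ?_
  simp only [axialSecond, radialSlope]
  norm_num
  ring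

/-- The regular domain of a profile pair. -/
theorem IsProfilePair.exists_radius {k ℓ : ℝ} {c G : ℝ → ℝ} (h : IsProfilePair k ℓ c G) :
    ∃ δ > 0, ∀ s, |s| < δ → AnalyticAt ℝ c s ∧ AnalyticAt ℝ G s ∧
      deriv G s = -2 * c s - 12 * s * deriv c s ∧
      12 * k * s - 2 * c s ^ 2 - deriv G s * c s = -2 * G s * deriv c s := by
  obtain ⟨δ, hδ, hball⟩ := Metric.eventually_nhds_iff.mp
    ((h.analyticAt_left.eventually_analyticAt).and
      ((h.analyticAt_right.eventually_analyticAt).and (h.deriv_right.and h.compat)))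
  exact ⟨δ, hδ, fun s hs => hball (by simpa using hs)⟩

theorem IsProfilePair.deriv_right_zero {k ℓ : ℝ} {c G : ℝ → ℝ} (h : IsProfilePair k ℓ c G) :
    deriv G 0 = 2 * k * ℓ ^ 2 := by
  rw [h.deriv_right.self_of_nhds, h.left_zero]; ring

/-- A continuous divided difference. -/
theorem exists_continuous_dividedDifference {c c₁ : ℝ → ℝ} {δ : ℝ} (hc₁ : Continuous c₁)
    (hc : ∀ s ∈ Icc (-δ) δ, HasDerivAt c (c₁ s) s) :
    ∃ Q : ℝ × ℝ → ℝ, Continuous Q ∧ (∀ x, Q (x, x) = c₁ x) ∧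
      ∀ x ∈ Icc (-δ) δ, ∀ y ∈ Icc (-δ) δ, c x - c y = Q (x, y) * (x - y) := by
  refine ⟨fun q => ∫ θ in (0 : ℝ)..1, c₁ (q.2 + θ * (q.1 - q.2)), ?_, fun x => by simp, ?_⟩
  · apply intervalIntegral.continuous_parametric_intervalIntegral_of_continuous'
    simp only [Function.uncurry_def]
    fun_prop
  · intro x hx y hy
    have hmem : ∀ θ ∈ uIcc (0 : ℝ) 1, y + θ * (x - y) ∈ Icc (-δ) δ := by
      intro θ hθ
      rw [uIcc_of_le zero_le_one] at hθ
      have := (convex_Icc (-δ) δ) hy hx (a := 1 - θ) (b := θ) (by linarith [hθ.2]) hθ.1 (by ring)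
      simp only [smul_eq_mul] at this
      convert this using 1; ring
    have hd : ∀ θ ∈ uIcc (0 : ℝ) 1,
        HasDerivAt (fun θ => c (y + θ * (x - y))) (c₁ (y + θ * (x - y)) * (x - y)) θ := by
      intro θ hθ
      refine (hc _ (hmem θ hθ)).comp θ ?_
      simpa using ((hasDerivAt_id θ).mul_const (x - y)).const_add y
    have := intervalIntegral.integral_eq_sub_of_hasDerivAt hd
      (Continuous.intervalIntegrable (by fun_prop) _ _)
    rw [intervalIntegral.integral_mul_const] at this
    simp only [one_mul, zero_mul, add_zero, add_sub_cancel] at this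
    exact this.symm

/-- Cauchy data are found on r = ℓ and carried along the radial flow. The candidate w for ψ_z is the
solution of the linear equation w_r = r c'(ψ) w; the remaining relations follow from uniqueness for
scalar linear equations in r. -/
theorem exists_isStreamPair {k ℓ : ℝ} {c G : ℝ → ℝ} (hk : 0 < k) (hℓ : 0 < ℓ)
    (h : IsProfilePair k ℓ c G) {δ : ℝ} (hδ : 0 < δ) (hδs : ∀ s, |s| < δ →
      AnalyticAt ℝ c s ∧ AnalyticAt ℝ G s ∧ deriv G s = -2 * c s - 12 * s * deriv c s ∧
      12 * k * s - 2 * c s ^ 2 - deriv G s * c s = -2 * G s * deriv c s) :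
    ∃ η > 0, ∃ ψ w : ℝ × ℝ → ℝ, ψ (ℓ, 0) = 0 ∧ w (ℓ, 0) = 0 ∧
      IsStreamPair k c G δ (Metric.ball (ℓ, 0) η) ψ w := by
  -- a globally continuous substitute for the derivative of `c`
  have hδ2 : 0 < δ / 2 := by positivity
  obtain ⟨π, hπ, hπm, hπe⟩ := exists_continuous_retraction_Icc 0 hδ2
  rw [zero_sub, zero_add] at hπm hπe
  have hlt : ∀ s ∈ Icc (-(δ / 2)) (δ / 2), |s| < δ := fun s hs =>
    (abs_le.mpr hs).trans_lt (by linarith)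
  set c₁ : ℝ → ℝ := fun s => deriv c (π s) with hc₁def
  have hc₁ : Continuous c₁ :=
    ContinuousOn.comp_continuous (s := Icc (-(δ / 2)) (δ / 2))
      (fun s hs => (hδs s (hlt s hs)).1.deriv.continuousAt.continuousWithinAt) hπ hπm
  have hc₁e : ∀ s ∈ Icc (-(δ / 2)) (δ / 2), c₁ s = deriv c s := fun s hs => by
    simp only [hc₁def, hπe s hs]
  have hcd : ∀ s ∈ Icc (-(δ / 2)) (δ / 2), HasDerivAt c (c₁ s) s := fun s hs => by
    rw [hc₁e s hs]; exact (hδs s (hlt s hs)).1.differentiableAt.hasDerivAt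
  obtain ⟨Q, hQ, hQd, hQe⟩ := exists_continuous_dividedDifference hc₁ hcd
  -- the radial flow and the profile on the line `r = ℓ`
  have hU1 : ContDiffAt ℝ 1 (radialSlope k c) (ℓ, 0) := by
    have h1 : ContDiffAt ℝ 1 (fun q : ℝ × ℝ => c q.2) (ℓ, 0) :=
      h.analyticAt_left.contDiffAt.snd'
    exact contDiffAt_fst.mul ((contDiffAt_const.mul (contDiffAt_fst.pow 2)).add h1)
  have hW1 : ContDiffAt ℝ 1 (fun s => axialSecond k c G (ℓ, s)) 0 := by
    have h1 : ContDiffAt ℝ 1 c 0 := h.analyticAt_left.contDiffAt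
    have h2 : ContDiffAt ℝ 1 (deriv c) 0 := h.analyticAt_left.deriv.contDiffAt
    have h3 : ContDiffAt ℝ 1 (deriv G) 0 := h.analyticAt_right.deriv.contDiffAt
    unfold axialSecond radialSlope
    fun_prop
  obtain ⟨η₁, hη₁, S, hS, hS0, hSd⟩ := exists_scalar_flow hU1
  -- The first-order equation g'² = `axialSq` with g(0) = 0 also admits g = 0. The second-order
  -- equation excludes it, as its right side is 2kℓ² > 0 at the start.
  obtain ⟨η₂, hη₂, g, g₁, hg, hg₁, hg0, hg₁0, hgd⟩ := exists_second_order_solution hW1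
  set ψ : ℝ × ℝ → ℝ := fun q => S (q.1, g q.2) with hψ
  have hψc : Continuous ψ := by fun_prop
  set w : ℝ × ℝ → ℝ := fun q => g₁ q.2 * Real.exp (∫ ρ in ℓ..q.1, ρ * c₁ (ψ (ρ, q.2))) with hw
  have hwc : Continuous w := by
    have : Continuous fun q : ℝ × ℝ => ∫ ρ in ℓ..q.1, ρ * c₁ (ψ (ρ, q.2)) := by
      apply intervalIntegral.continuous_parametric_intervalIntegral_of_continuous
      · simp only [Function.uncurry_def]; fun_prop
      · fun_prop
    fun_prop
  have hψ0 : ψ (ℓ, 0) = 0 := by simp [hψ, hg0, hS0 0 (by simp [hη₁.le])]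
  have hw0 : w (ℓ, 0) = 0 := by simp [hw, hg₁0]
  -- a neighbourhood where everything is under control
  have hWpos : 0 < axialSecond k c G (ℓ, 0) := by
    have : axialSecond k c G (ℓ, 0) = 2 * k * ℓ ^ 2 := by
      simp only [axialSecond, radialSlope, h.left_zero, h.deriv_right_zero]; ring
    rw [this]; positivity
  obtain ⟨η, hη, hηN⟩ : ∃ η > 0, ∀ q ∈ Metric.ball ((ℓ, 0) : ℝ × ℝ) η,
      |ψ q| < δ / 2 ∧ |q.1 - ℓ| < η₁ ∧ |q.2| < η₂ ∧ |g q.2| < η₁ ∧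
        0 < axialSecond k c G (ℓ, g q.2) := by
    refine Metric.eventually_nhds_iff_ball.mp ?_
    have e1 : ∀ᶠ q in 𝓝 ((ℓ, 0) : ℝ × ℝ), |ψ q| < δ / 2 :=
      hψc.abs.continuousAt.eventually (gt_mem_nhds (by simp [hψ0, hδ]))
    have e2 : ∀ᶠ q in 𝓝 ((ℓ, 0) : ℝ × ℝ), |q.1 - ℓ| < η₁ :=
      (continuous_fst.sub continuous_const).abs.continuousAt.eventually
        (gt_mem_nhds (by simp [hη₁]))
    have e3 : ∀ᶠ q in 𝓝 ((ℓ, 0) : ℝ × ℝ), |q.2| < η₂ :=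
      continuous_snd.abs.continuousAt.eventually (gt_mem_nhds (by simp [hη₂]))
    have e4 : ∀ᶠ q in 𝓝 ((ℓ, 0) : ℝ × ℝ), |g q.2| < η₁ :=
      (hg.comp continuous_snd).abs.continuousAt.eventually (gt_mem_nhds (by simp [hg0, hη₁]))
    have e5 : ∀ᶠ q in 𝓝 ((ℓ, 0) : ℝ × ℝ), 0 < axialSecond k c G (ℓ, g q.2) := by
      have : ContinuousAt (fun q : ℝ × ℝ => axialSecond k c G (ℓ, g q.2)) (ℓ, 0) :=
        ContinuousAt.comp (g := fun s => axialSecond k c G (ℓ, s)) (f := fun q : ℝ × ℝ => g q.2)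
          (by simpa [hg0] using hW1.continuousAt) (hg.comp continuous_snd).continuousAt
      exact this.eventually (lt_mem_nhds (by simpa [hg0] using hWpos))
    filter_upwards [e1, e2, e3, e4, e5] with q h1 h2 h3 h4 h5 using ⟨h1, h2, h3, h4, h5⟩
  have hbox : ∀ {r z : ℝ}, |r - ℓ| < η → |z| < η → (r, z) ∈ Metric.ball ((ℓ, 0) : ℝ × ℝ) η := by
    intro r z hr hz
    simp [Prod.dist_eq, Real.dist_eq, hr, hz]
  have hbox' : ∀ {q : ℝ × ℝ}, q ∈ Metric.ball ((ℓ, 0) : ℝ × ℝ) η → |q.1 - ℓ| < η ∧ |q.2| < η := by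
    intro q hq
    simpa [Prod.dist_eq, Real.dist_eq] using hq
  have hℓη : |ℓ - ℓ| < η := by simpa using hη
  have hψδ : ∀ {q : ℝ × ℝ}, q ∈ Metric.ball ((ℓ, 0) : ℝ × ℝ) η →
      ψ q ∈ Icc (-(δ / 2)) (δ / 2) := fun hq => abs_le.mp (hηN _ hq).1.le
  have hψℓ : ∀ {z : ℝ}, |z| < η → ψ (ℓ, z) = g z := fun hz =>
    hS0 _ (hηN _ (hbox hℓη hz)).2.2.2.1.le
  -- the radial derivatives
  have hψr : ∀ {r z : ℝ}, |r - ℓ| < η → |z| < η →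
      HasDerivAt (fun r => ψ (r, z)) (radialSlope k c (r, ψ (r, z))) r := fun hr hz =>
    hSd _ _ (hηN _ (hbox hr hz)).2.2.2.1.le (hηN _ (hbox hr hz)).2.1
  have hwr : ∀ r z : ℝ, HasDerivAt (fun r => w (r, z)) (r * c₁ (ψ (r, z)) * w (r, z)) r := by
    intro r z
    have hcont : Continuous fun ρ => ρ * c₁ (ψ (ρ, z)) := by fun_prop
    have := ((hcont.integral_hasStrictDerivAt ℓ r).hasDerivAt.exp).const_mul (g₁ z)
    refine this.congr_deriv ?_
    simp only [hw]; ring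
  -- conservation laws
  have hgV : ∀ {z : ℝ}, |z| < η → g₁ z ^ 2 = axialSq k c G (ℓ, g z) := by
    intro z hz
    have hd : ∀ t ∈ Metric.ball (0 : ℝ) η,
        HasDerivAt (fun z => g₁ z ^ 2 - axialSq k c G (ℓ, g z)) 0 t := by
      intro t ht
      have ht' : |t| < η := by simpa using ht
      have hb := hbox hℓη ht'
      obtain ⟨hgt, hg₁t⟩ := hgd t (hηN _ hb).2.2.1
      have hgs : |g t| < δ := hψℓ ht' ▸ hlt _ (hψδ hb)
      have e := hasDerivAt_axialSq_axial (k := k) (r := ℓ) (hδs _ hgs).1.differentiableAt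
        (hδs _ hgs).2.1.differentiableAt hgt
      refine ((hg₁t.fun_pow 2).fun_sub e).congr_deriv ?_
      norm_num; ring
    have := Metric.isOpen_ball.is_const_of_deriv_eq_zero (convex_ball (0 : ℝ) η).isPreconnected
      (fun x hx => (hd x hx).differentiableAt.differentiableWithinAt)
      (fun x hx => (hd x hx).deriv) (show z ∈ Metric.ball (0 : ℝ) η by simpa using hz)
      (Metric.mem_ball_self hη)
    have h0 : axialSq k c G (ℓ, 0) = 0 := by
      simp [axialSq, radialSlope, h.right_zero, h.left_zero]
    simp only [hg0, hg₁0, h0] at this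
    linarith
  -- Both sides solve the same linear equation in r, so their difference, which vanishes at r = ℓ by
  -- `hgV`, vanishes identically.
  have hsq : ∀ {r z : ℝ}, |r - ℓ| < η → |z| < η → w (r, z) ^ 2 = axialSq k c G (r, ψ (r, z)) := by
    intro r z hr hz
    have hcont : Continuous fun ρ => 2 * (ρ * c₁ (ψ (ρ, z))) := by fun_prop
    have key : ∀ t, |t - ℓ| < η → HasDerivAt (fun r => w (r, z) ^ 2 - axialSq k c G (r, ψ (r, z)))
        (2 * (t * c₁ (ψ (t, z))) * (w (t, z) ^ 2 - axialSq k c G (t, ψ (t, z)))) t := by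
      intro t ht
      have hm := hψδ (hbox ht hz)
      obtain ⟨a1, a2, a3, a4⟩ := hδs _ (hlt _ hm)
      have e := hasDerivAt_axialSq_radial (y := fun r => ψ (r, z)) a1.differentiableAt
        a2.differentiableAt a4 a3 (hψr ht hz)
      rw [← hc₁e _ hm] at e
      refine (((hwr t z).fun_pow 2).fun_sub e).congr_deriv ?_
      norm_num; ring
    have := eq_mul_exp_integral hcont key hr
    have hw1 : w (ℓ, z) = g₁ z := by simp [hw]
    rw [hψℓ hz, hw1, hgV hz, sub_self, zero_mul] at this
    linarith
  -- the axial derivatives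
  have hψz : ∀ {r z : ℝ}, |r - ℓ| < η → |z| < η → HasDerivAt (fun z => ψ (r, z)) (w (r, z)) z := by
    intro r z hr hz
    have hgz := (hgd z (hηN _ (hbox hr hz)).2.2.1).1
    -- With the divided difference Q of c, the difference of two radial trajectories solves a linear
    -- equation exactly and equals (g(y) - g(z))K(y). Continuity of K then suffices, with no smooth
    -- dependence on initial data.
    set K : ℝ → ℝ := fun y => Real.exp (∫ ρ in ℓ..r, ρ * Q (ψ (ρ, y), ψ (ρ, z))) with hK
    have hKc : Continuous K := by
      refine Real.continuous_exp.comp ?_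
      apply intervalIntegral.continuous_parametric_intervalIntegral_of_continuous'
      simp only [Function.uncurry_def]; fun_prop
    have hKz : g₁ z * K z = w (r, z) := by simp only [hK, hw, hQd]
    rw [← hKz]
    refine hasDerivAt_of_sub_eq_mul hgz hKc.continuousAt ?_
    filter_upwards [continuous_abs.continuousAt.eventually (gt_mem_nhds hz)] with y hy
    have hcont : Continuous fun ρ => ρ * Q (ψ (ρ, y), ψ (ρ, z)) := by fun_prop
    have key : ∀ t, |t - ℓ| < η → HasDerivAt (fun r => ψ (r, y) - ψ (r, z))
        (t * Q (ψ (t, y), ψ (t, z)) * (ψ (t, y) - ψ (t, z))) t := by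
      intro t ht
      refine ((hψr ht hy).fun_sub (hψr ht hz)).congr_deriv ?_
      have := hQe _ (hψδ (hbox ht hy)) _ (hψδ (hbox ht hz))
      simp only [radialSlope]
      linear_combination t * this
    have := eq_mul_exp_integral hcont key hr
    rw [hψℓ hy, hψℓ hz] at this
    exact this
  have hWcont : ∀ {q : ℝ × ℝ}, q ∈ Metric.ball ((ℓ, 0) : ℝ × ℝ) η →
      ContinuousAt (fun q : ℝ × ℝ => axialSecond k c G (q.1, ψ q)) q := by
    intro q hq
    obtain ⟨a1, a2, -, -⟩ := hδs _ (hlt _ (hψδ hq))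
    have c1 : ContinuousAt (fun q => c (ψ q)) q :=
      ContinuousAt.comp (f := ψ) a1.continuousAt hψc.continuousAt
    have c2 : ContinuousAt (fun q => deriv c (ψ q)) q :=
      ContinuousAt.comp (f := ψ) a1.deriv.continuousAt hψc.continuousAt
    have c3 : ContinuousAt (fun q => deriv G (ψ q)) q :=
      ContinuousAt.comp (f := ψ) a2.deriv.continuousAt hψc.continuousAt
    unfold axialSecond radialSlope
    fun_prop
  have hg₁ne : ∀ {z : ℝ}, |z| < η → z ≠ 0 → g₁ z ≠ 0 := by
    -- The second derivative of g is positive, so g₁ vanishes only at z = 0 and w is nonzero off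
    -- that line.
    have hmono : StrictMonoOn g₁ (Metric.ball (0 : ℝ) η) := by
      refine strictMonoOn_of_deriv_pos (convex_ball _ _) hg₁.continuousOn ?_
      intro t ht
      rw [Metric.isOpen_ball.interior_eq] at ht
      have hb := hbox hℓη (show |t| < η by simpa using ht)
      rw [(hgd t (hηN _ hb).2.2.1).2.deriv]
      exact (hηN _ hb).2.2.2.2
    intro z hz hz0 hcon
    exact hz0 (hmono.injOn (show z ∈ Metric.ball (0 : ℝ) η by simpa using hz)
      (Metric.mem_ball_self hη) (hcon.trans hg₁0.symm))
  have hwz : ∀ {r z : ℝ}, |r - ℓ| < η → |z| < η →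
      HasDerivAt (fun z => w (r, z)) (axialSecond k c G (r, ψ (r, z))) z := by
    intro r z hr hz
    -- Off z = 0, differentiate w² = `axialSq` and divide by 2w.
    have hne : ∀ y, |y| < η → y ≠ 0 →
        HasDerivAt (fun z => w (r, z)) (axialSecond k c G (r, ψ (r, y))) y := by
      intro y hy hy0
      obtain ⟨a1, a2, -, -⟩ := hδs _ (hlt _ (hψδ (hbox hr hy)))
      have hwne : w (r, y) ≠ 0 := mul_ne_zero (hg₁ne hy hy0) (Real.exp_ne_zero _)
      have e := hasDerivAt_axialSq_axial (k := k) (r := r) (y := fun z => ψ (r, z))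
        a1.differentiableAt a2.differentiableAt (hψz hr hy)
      refine (hasDerivAt_of_sq_eventuallyEq (w := fun z => w (r, z))
        (by fun_prop) hwne e ?_).congr_deriv ?_
      · filter_upwards [continuous_abs.continuousAt.eventually (gt_mem_nhds hy)] with x hx
        exact hsq hr hx
      · field_simp
    rcases eq_or_ne z 0 with rfl | hz0
    · refine hasDerivAt_of_eventually_hasDerivAt_of_ne (f := fun z => w (r, z))
        (g := fun z => axialSecond k c G (r, ψ (r, z))) ?_ (by fun_prop) ?_
      · filter_upwards [continuous_abs.continuousAt.eventually (gt_mem_nhds hz)] with x hx hx0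
        exact hne x hx hx0
      · exact ContinuousAt.comp (f := fun z : ℝ => (r, z)) (hWcont (hbox hr hz)) (by fun_prop)
    · exact hne z hz hz0
  have hnear : ∀ q ∈ Metric.ball ((ℓ, 0) : ℝ × ℝ) η, ∀ᶠ p in 𝓝 q, |p.1 - ℓ| < η ∧ |p.2| < η :=
    fun q hq => by
      filter_upwards [Metric.isOpen_ball.mem_nhds hq] with p hp using hbox' hp
  have hUcont : ∀ {q : ℝ × ℝ}, q ∈ Metric.ball ((ℓ, 0) : ℝ × ℝ) η →
      ContinuousAt (fun q : ℝ × ℝ => radialSlope k c (q.1, ψ q)) q := by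
    intro q hq
    have c1 : ContinuousAt (fun q => c (ψ q)) q :=
      ContinuousAt.comp (f := ψ) (hδs _ (hlt _ (hψδ hq))).1.continuousAt hψc.continuousAt
    exact continuousAt_fst.mul ((continuousAt_const.mul (continuousAt_fst.pow 2)).add c1)
  refine ⟨η, hη, ψ, w, hψ0, hw0, ⟨fun q hq => hlt _ (hψδ hq), fun q hq => ?_, fun q hq => ?_,
    fun q hq => hsq (hbox' hq).1 (hbox' hq).2⟩⟩
  · exact hasFDerivAt_of_partial (a := fun q => radialSlope k c (q.1, ψ q)) (b := w)
      ((hnear q hq).mono fun p hp => hψr hp.1 hp.2)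
      ((hnear q hq).mono fun p hp => hψz hp.1 hp.2) (hUcont hq) hwc.continuousAt
  · have := hasFDerivAt_of_partial (f := w) (a := fun q => q.1 * c₁ (ψ q) * w q)
      (b := fun q => axialSecond k c G (q.1, ψ q))
      (Eventually.of_forall fun p => hwr p.1 p.2)
      ((hnear q hq).mono fun p hp => hwz hp.1 hp.2) (by fun_prop) (hWcont hq)
    rwa [hc₁e _ (hψδ hq)] at this

/-! ### Bounded Lipschitz functions -/

/-- `f` is bounded and Lipschitz on `s`. -/
def BoundedLipschitzOn {X : Type*} [PseudoMetricSpace X] (f : X → ℝ) (s : Set X) : Prop :=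
  ∃ K : ℝ, 0 ≤ K ∧ (∀ x ∈ s, |f x| ≤ K) ∧ ∀ x ∈ s, ∀ y ∈ s, |f x - f y| ≤ K * dist x y

namespace BoundedLipschitzOn

variable {X Y : Type*} [PseudoMetricSpace X] [PseudoMetricSpace Y] {f g : X → ℝ} {s : Set X}

theorem of_bounds {K L : ℝ} (hK : ∀ x ∈ s, |f x| ≤ K)
    (hL : ∀ x ∈ s, ∀ y ∈ s, |f x - f y| ≤ L * dist x y) : BoundedLipschitzOn f s := by
  refine ⟨max 0 (max K L), le_max_left _ _,
    fun x hx => (hK x hx).trans ((le_max_left _ _).trans (le_max_right _ _)),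
    fun x hx y hy => (hL x hx y hy).trans ?_⟩
  exact mul_le_mul_of_nonneg_right ((le_max_right _ _).trans (le_max_right _ _)) dist_nonneg

theorem mono {t : Set X} (hf : BoundedLipschitzOn f t) (h : s ⊆ t) : BoundedLipschitzOn f s := by
  obtain ⟨K, hK, h1, h2⟩ := hf
  exact ⟨K, hK, fun x hx => h1 x (h hx), fun x hx y hy => h2 x (h hx) y (h hy)⟩

theorem congr (hf : BoundedLipschitzOn f s) (h : ∀ x ∈ s, g x = f x) : BoundedLipschitzOn g s := by
  obtain ⟨K, hK, h1, h2⟩ := hf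
  exact ⟨K, hK, fun x hx => h x hx ▸ h1 x hx, fun x hx y hy => h x hx ▸ h y hy ▸ h2 x hx y hy⟩

theorem const (a : ℝ) : BoundedLipschitzOn (fun _ : X => a) s :=
  of_bounds (K := |a|) (L := 0) (fun _ _ => le_rfl) (fun _ _ _ _ => by simp)

theorem neg (hf : BoundedLipschitzOn f s) : BoundedLipschitzOn (fun x => -f x) s := by
  obtain ⟨K, hK, h1, h2⟩ := hf
  refine ⟨K, hK, fun x hx => by rw [abs_neg]; exact h1 x hx, fun x hx y hy => ?_⟩
  rw [neg_sub_neg, abs_sub_comm]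
  exact h2 x hx y hy

theorem add (hf : BoundedLipschitzOn f s) (hg : BoundedLipschitzOn g s) :
    BoundedLipschitzOn (fun x => f x + g x) s := by
  obtain ⟨K, hK, h1, h2⟩ := hf
  obtain ⟨L, hL, h3, h4⟩ := hg
  refine ⟨K + L, add_nonneg hK hL,
    fun x hx => (abs_add_le _ _).trans (add_le_add (h1 x hx) (h3 x hx)), fun x hx y hy => ?_⟩
  calc |f x + g x - (f y + g y)| = |(f x - f y) + (g x - g y)| := by ring_nf
    _ ≤ K * dist x y + L * dist x y :=
      (abs_add_le _ _).trans (add_le_add (h2 x hx y hy) (h4 x hx y hy))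
    _ = _ := by ring

theorem sub (hf : BoundedLipschitzOn f s) (hg : BoundedLipschitzOn g s) :
    BoundedLipschitzOn (fun x => f x - g x) s := by
  simpa [sub_eq_add_neg] using hf.add hg.neg

theorem mul (hf : BoundedLipschitzOn f s) (hg : BoundedLipschitzOn g s) :
    BoundedLipschitzOn (fun x => f x * g x) s := by
  obtain ⟨K, hK, h1, h2⟩ := hf
  obtain ⟨L, hL, h3, h4⟩ := hg
  refine of_bounds (K := K * L) (L := K * L + K * L) (fun x hx => ?_) fun x hx y hy => ?_
  · rw [abs_mul]
    exact mul_le_mul (h1 x hx) (h3 x hx) (abs_nonneg _) hK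
  · calc |f x * g x - f y * g y| = |(f x - f y) * g x + f y * (g x - g y)| := by ring_nf
      _ ≤ |f x - f y| * |g x| + |f y| * |g x - g y| := by
        refine (abs_add_le _ _).trans ?_
        rw [abs_mul, abs_mul]
      _ ≤ K * dist x y * L + K * (L * dist x y) := by
        have := h1 y hy; have := h2 x hx y hy; have := h3 x hx; have := h4 x hx y hy
        gcongr
      _ = _ := by ring

theorem inv_of_le {m : ℝ} (hm : 0 < m) (hf : BoundedLipschitzOn f s) (h : ∀ x ∈ s, m ≤ f x) :
    BoundedLipschitzOn (fun x => (f x)⁻¹) s := by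
  obtain ⟨K, hK, h1, h2⟩ := hf
  refine of_bounds (K := m⁻¹) (L := K / (m * m)) (fun x hx => ?_) fun x hx y hy => ?_
  · have := hm.trans_le (h x hx)
    rw [abs_of_pos (inv_pos.mpr this)]
    exact inv_anti₀ hm (h x hx)
  · have hx' := hm.trans_le (h x hx)
    have hy' := hm.trans_le (h y hy)
    rw [inv_sub_inv hx'.ne' hy'.ne', abs_div, abs_of_pos (mul_pos hx' hy'), abs_sub_comm,
      div_mul_eq_mul_div]
    exact div_le_div₀ (by positivity) (h2 x hx y hy) (by positivity)
      (mul_le_mul (h x hx) (h y hy) hm.le hx'.le)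

theorem comp {u : Set Y} {φ : Y → X} (hf : BoundedLipschitzOn f s) {L : ℝ}
    (hφ : ∀ x ∈ u, ∀ y ∈ u, dist (φ x) (φ y) ≤ L * dist x y)
    (hm : MapsTo φ u s) : BoundedLipschitzOn (fun y => f (φ y)) u := by
  obtain ⟨K, hK, h1, h2⟩ := hf
  refine of_bounds (K := K) (L := K * L) (fun x hx => h1 _ (hm hx)) fun x hx y hy => ?_
  calc |f (φ x) - f (φ y)| ≤ K * dist (φ x) (φ y) := h2 _ (hm hx) _ (hm hy)
    _ ≤ K * (L * dist x y) := by gcongr; exact hφ x hx y hy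
    _ = _ := by ring

theorem lipschitzOnWith (hf : BoundedLipschitzOn f s) : ∃ K : ℝ≥0, LipschitzOnWith K f s := by
  obtain ⟨K, hK, -, h2⟩ := hf
  exact ⟨⟨K, hK⟩, LipschitzOnWith.of_dist_le_mul fun x hx y hy => h2 x hx y hy⟩

theorem of_hasFDerivAt {E : Type*} [NormedAddCommGroup E] [NormedSpace ℝ E] {f : E → ℝ}
    {f' : E → E →L[ℝ] ℝ} {s : Set E} (hs : Convex ℝ s) (hsc : IsCompact s)
    (hf : ∀ x ∈ s, HasFDerivAt f (f' x) x) {K : ℝ} (hK : ∀ x ∈ s, ‖f' x‖ ≤ K) :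
    BoundedLipschitzOn f s := by
  obtain ⟨M, hM⟩ := hsc.exists_bound_of_continuousOn (f := f)
    fun x hx => (hf x hx).continuousAt.continuousWithinAt
  refine of_bounds (K := M) (L := K) hM fun x hx y hy => ?_
  rw [dist_eq_norm, ← Real.norm_eq_abs]
  exact hs.norm_image_sub_le_of_norm_hasFDerivWithin_le
    (fun z hz => (hf z hz).hasFDerivWithinAt) hK hy hx

theorem of_contDiffOn {E : Type*} [NormedAddCommGroup E] [NormedSpace ℝ E] {f : E → ℝ}
    {s u : Set E} (hs : Convex ℝ s) (hsc : IsCompact s) (hu : IsOpen u) (hsu : s ⊆ u)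
    (hf : ContDiffOn ℝ 1 f u) : BoundedLipschitzOn f s := by
  obtain ⟨M, hM⟩ := hsc.exists_bound_of_continuousOn (f := fderiv ℝ f)
    ((hf.continuousOn_fderiv_of_isOpen hu le_rfl).mono hsu)
  exact of_hasFDerivAt hs hsc (fun x hx =>
    ((hf.contDiffAt (hu.mem_nhds (hsu hx))).differentiableAt one_ne_zero).hasFDerivAt) hM

end BoundedLipschitzOn

/-! ### Regularity and positivity of the stream function -/

theorem norm_smul_fst_add_smul_snd_le (a b : ℝ) :
    ‖a • ContinuousLinearMap.fst ℝ ℝ ℝ + b • ContinuousLinearMap.snd ℝ ℝ ℝ‖ ≤ |a| + |b| := by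
  refine (norm_add_le _ _).trans (add_le_add ?_ ?_)
  · rw [norm_smul, Real.norm_eq_abs]
    exact mul_le_of_le_one_right (abs_nonneg _) (ContinuousLinearMap.norm_fst_le ℝ ℝ ℝ)
  · rw [norm_smul, Real.norm_eq_abs]
    exact mul_le_of_le_one_right (abs_nonneg _) (ContinuousLinearMap.norm_snd_le ℝ ℝ ℝ)

namespace IsStreamPair

variable {k δ : ℝ} {c G : ℝ → ℝ} {N : Set (ℝ × ℝ)} {ψ w : ℝ × ℝ → ℝ}

/-- Bootstrap: the derivatives of (ψ, w) are analytic expressions in r, ψ and w, so each order of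
smoothness yields the next. -/
theorem contDiffOn_left_right (h : IsStreamPair k c G δ N ψ w) (hN : IsOpen N)
    (hc : ∀ s, |s| < δ → AnalyticAt ℝ c s) (hG : ∀ s, |s| < δ → AnalyticAt ℝ G s) :
    ContDiffOn ℝ ∞ ψ N ∧ ContDiffOn ℝ ∞ w N := by
  have key : ∀ n : ℕ, ContDiffOn ℝ n ψ N ∧ ContDiffOn ℝ n w N := by
    intro n
    induction n with
    | zero =>
      simp only [CharP.cast_eq_zero, contDiffOn_zero]
      exact ⟨fun q hq => (h.hasFDerivAt_left q hq).continuousAt.continuousWithinAt,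
        fun q hq => (h.hasFDerivAt_right q hq).continuousAt.continuousWithinAt⟩
    | succ n ih =>
      obtain ⟨hψ, hw⟩ := ih
      have e : ∀ {a : ℝ → ℝ}, (∀ s, |s| < δ → AnalyticAt ℝ a s) →
          ContDiffOn ℝ n (fun q => a (ψ q)) N := by
        intro a ha q hq
        exact (ha _ (h.abs_lt q hq)).contDiffAt.comp_contDiffWithinAt q (hψ q hq)
      have c1 := e hc
      have c2 := e fun s hs => (hc s hs).deriv
      have c3 := e fun s hs => (hG s hs).deriv
      have hr : ContDiffOn ℝ n (fun q : ℝ × ℝ => q.1) N := contDiffOn_fst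
      have hU : ContDiffOn ℝ n (fun q => radialSlope k c (q.1, ψ q)) N :=
        hr.mul ((contDiffOn_const.mul (hr.pow 2)).add c1)
      have hW : ContDiffOn ℝ n (fun q => axialSecond k c G (q.1, ψ q)) N :=
        (((contDiffOn_const.mul (hr.pow 2)).sub c3).sub
          ((contDiffOn_const.mul hU).mul (hr.mul c2))).div_const 2
      have hw₁ : ContDiffOn ℝ n (fun q => q.1 * deriv c (ψ q) * w q) N := (hr.mul c2).mul hw
      push_cast
      rw [contDiffOn_succ_iff_fderiv_of_isOpen hN, contDiffOn_succ_iff_fderiv_of_isOpen hN]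
      refine ⟨⟨fun q hq => (h.hasFDerivAt_left q hq).differentiableAt.differentiableWithinAt,
        by simp, ?_⟩,
        ⟨fun q hq => (h.hasFDerivAt_right q hq).differentiableAt.differentiableWithinAt,
        by simp, ?_⟩⟩
      · exact ((hU.smul contDiffOn_const).add (hw.smul contDiffOn_const)).congr
          fun q hq => (h.hasFDerivAt_left q hq).fderiv
      · exact ((hw₁.smul contDiffOn_const).add (hW.smul contDiffOn_const)).congr
          fun q hq => (h.hasFDerivAt_right q hq).fderiv
  exact ⟨contDiffOn_infty.mpr fun n => (key n).1, contDiffOn_infty.mpr fun n => (key n).2⟩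

theorem hasFDerivAt_radialSlope (h : IsStreamPair k c G δ N ψ w)
    (hc : ∀ s, |s| < δ → AnalyticAt ℝ c s) {q : ℝ × ℝ} (hq : q ∈ N) :
    HasFDerivAt (fun q => radialSlope k c (q.1, ψ q))
      ((3 * k * q.1 ^ 2 + c (ψ q) + q.1 * deriv c (ψ q) * radialSlope k c (q.1, ψ q)) •
        ContinuousLinearMap.fst ℝ ℝ ℝ
      + (q.1 * deriv c (ψ q) * w q) • ContinuousLinearMap.snd ℝ ℝ ℝ) q := by
  have h1 := (hc _ (h.abs_lt q hq)).differentiableAt.hasDerivAt.comp_hasFDerivAt q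
    (h.hasFDerivAt_left q hq)
  have hr : HasFDerivAt (fun q : ℝ × ℝ => q.1) (ContinuousLinearMap.fst ℝ ℝ ℝ) q := hasFDerivAt_fst
  have := hr.fun_mul ((((hasDerivAt_pow 2 q.1).comp_hasFDerivAt q hr).const_mul k).fun_add h1)
  refine this.congr_fderiv ?_
  ext <;> simp [radialSlope] <;> ring

/-- The gradient (ψ_r, ψ_z) vanishes at the centre with Jacobian 2kℓ² times the identity. Its
component along rays is therefore positive nearby, and ψ increases strictly from 0 along each
segment leaving the centre. -/
theorem exists_pos (h : IsStreamPair k c G δ N ψ w) {ℓ : ℝ} (hk : 0 < k) (hℓ : 0 < ℓ)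
    (hN : N ∈ 𝓝 ((ℓ, 0) : ℝ × ℝ)) (hp : IsProfilePair k ℓ c G)
    (hc : ∀ s, |s| < δ → AnalyticAt ℝ c s) (hψ0 : ψ (ℓ, 0) = 0) (hw0 : w (ℓ, 0) = 0) :
    ∃ η > 0, Metric.ball (ℓ, 0) η ⊆ N ∧
      ∀ q ∈ Metric.ball ((ℓ, 0) : ℝ × ℝ) η, q ≠ (ℓ, 0) → 0 < ψ q := by
  have hmem : ((ℓ, 0) : ℝ × ℝ) ∈ N := mem_of_mem_nhds hN
  have hU0 : radialSlope k c (ℓ, 0) = 0 := by simp [radialSlope, hp.left_zero]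
  have d1 := h.hasFDerivAt_radialSlope hc hmem
  have d2 := h.hasFDerivAt_right _ hmem
  -- With this tolerance the two linearization errors total at most kℓ²(x² + z²), half of the main
  -- term 2kℓ²(x² + z²).
  have hm : 0 < k * ℓ ^ 2 / 2 := by positivity
  have e1 := (hasFDerivAt_iff_isLittleO.mp d1).def hm
  have e2 := (hasFDerivAt_iff_isLittleO.mp d2).def hm
  simp only [hψ0, hU0, hw0, axialSecond, hp.left_zero, hp.deriv_right_zero] at e1 e2
  obtain ⟨η, hη, hball⟩ := Metric.eventually_nhds_iff_ball.mp (e1.and (e2.and hN))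
  have hsub : Metric.ball (ℓ, 0) η ⊆ N := fun q hq => (hball q hq).2.2
  have hD : ∀ q ∈ Metric.ball ((ℓ, 0) : ℝ × ℝ) η, q ≠ (ℓ, 0) →
      0 < (q.1 - ℓ) * radialSlope k c (q.1, ψ q) + q.2 * w q := by
    intro q hq hne
    obtain ⟨b1, b2, -⟩ := hball q hq
    obtain ⟨x, hx⟩ : ∃ x, x = q.1 - ℓ := ⟨_, rfl⟩
    simp only [add_apply, smul_apply,
      ContinuousLinearMap.coe_fst', ContinuousLinearMap.coe_snd', Prod.fst_sub, Prod.snd_sub,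
      smul_eq_mul, Real.norm_eq_abs, sub_zero, mul_zero, zero_mul, add_zero, zero_add,
      Prod.norm_def, ← hx] at b1 b2
    rw [← hx]
    have hne' : 0 < x ^ 2 + q.2 ^ 2 := by
      by_contra hcon
      have h1 : x = 0 := by nlinarith [sq_nonneg x, sq_nonneg q.2]
      have h2 : q.2 = 0 := by nlinarith [sq_nonneg x, sq_nonneg q.2]
      exact hne (Prod.ext (by simp only; linarith) h2)
    set M := max |x| |q.2| with hM
    generalize radialSlope k c (q.1, ψ q) = p at *
    generalize w q = v at *
    generalize q.2 = z at *
    have c1 : |x * (p - 2 * k * ℓ ^ 2 * x)| ≤ k * ℓ ^ 2 / 2 * (M * |x|) := by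
      rw [abs_mul]
      calc _ ≤ |x| * (k * ℓ ^ 2 / 2 * M) := by
            gcongr
            refine le_trans (le_of_eq ?_) b1
            congr 1; ring
        _ = _ := by ring
    have c2 : |z * (v - 2 * k * ℓ ^ 2 * z)| ≤ k * ℓ ^ 2 / 2 * (M * |z|) := by
      rw [abs_mul]
      calc _ ≤ |z| * (k * ℓ ^ 2 / 2 * M) := by
            gcongr
            refine le_trans (le_of_eq ?_) b2
            congr 1; ring
        _ = _ := by ring
    have c3 : M * |x| + M * |z| ≤ 2 * (x ^ 2 + z ^ 2) := by
      rw [← sq_abs x, ← sq_abs z, hM]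
      rcases max_cases |x| |z| with ⟨e, _⟩ | ⟨e, _⟩ <;> rw [e] <;>
        nlinarith [sq_nonneg (|x| - |z|), sq_nonneg (|x|), sq_nonneg (|z|)]
    have c4 := (abs_le.mp c1).1
    have c5 := (abs_le.mp c2).1
    have c6 : 0 < k * ℓ ^ 2 * (x ^ 2 + z ^ 2) := by positivity
    have c7 := mul_le_mul_of_nonneg_left c3 hm.le
    nlinarith
  refine ⟨η, hη, hsub, fun q hq hne => ?_⟩
  set L : ℝ → ℝ × ℝ := fun t => (ℓ + t * (q.1 - ℓ), t * q.2) with hL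
  have hLmem : ∀ t ∈ Icc (0 : ℝ) 1, L t ∈ Metric.ball ((ℓ, 0) : ℝ × ℝ) η := by
    intro t ht
    have := (convex_ball ((ℓ, 0) : ℝ × ℝ) η) (Metric.mem_ball_self hη) hq (a := 1 - t) (b := t)
      (by linarith [ht.2]) ht.1 (by ring)
    convert this using 1
    ext <;> simp [hL]; ring
  have hLd : ∀ t, HasDerivAt L (q.1 - ℓ, q.2) t := fun t => by
    have h1 : HasDerivAt (fun t : ℝ => ℓ + t * (q.1 - ℓ)) (q.1 - ℓ) t := by
      simpa using ((hasDerivAt_id t).mul_const (q.1 - ℓ)).const_add ℓ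
    have h2 : HasDerivAt (fun t : ℝ => t * q.2) q.2 t := by
      simpa using (hasDerivAt_id t).mul_const q.2
    exact h1.prodMk h2
  have hψd : ∀ t ∈ Icc (0 : ℝ) 1, HasDerivAt (fun t => ψ (L t))
      (radialSlope k c ((L t).1, ψ (L t)) * (q.1 - ℓ) + w (L t) * q.2) t := by
    intro t ht
    have : HasDerivAt (fun t => ψ (L t)) _ t :=
      (h.hasFDerivAt_left _ (hsub (hLmem t ht))).comp_hasDerivAt t (hLd t)
    exact this.congr_deriv (by simp)
  have hmono : StrictMonoOn (fun t => ψ (L t)) (Icc (0 : ℝ) 1) := by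
    refine strictMonoOn_of_deriv_pos (convex_Icc 0 1)
      (fun t ht => (hψd t ht).continuousAt.continuousWithinAt) fun t ht => ?_
    rw [interior_Icc] at ht
    rw [(hψd t (Ioo_subset_Icc_self ht)).deriv]
    have hne' : L t ≠ (ℓ, 0) := by
      intro hcon
      apply hne
      have h1 : ℓ + t * (q.1 - ℓ) = ℓ := congrArg Prod.fst hcon
      have h2 : t * q.2 = 0 := congrArg Prod.snd hcon
      have h3 : q.2 = 0 := (mul_eq_zero.mp h2).resolve_left ht.1.ne'
      have h4 : q.1 - ℓ = 0 := (mul_eq_zero.mp (by linarith : t * (q.1 - ℓ) = 0)).resolve_left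
        ht.1.ne'
      exact Prod.ext (by simp only; linarith) h3
    have := hD _ (hLmem t (Ioo_subset_Icc_self ht)) hne'
    have e : (L t).1 - ℓ = t * (q.1 - ℓ) := by simp [hL]
    have e' : (L t).2 = t * q.2 := rfl
    rw [e, e'] at this
    refine pos_of_mul_pos_right (a := t) ?_ ht.1.le
    linarith
  have := hmono (left_mem_Icc.mpr zero_le_one) (right_mem_Icc.mpr zero_le_one) zero_lt_one
  simpa [hL, hψ0] using this

end IsStreamPair

/-! ### The vortex core -/

/-- A solution of the overdetermined system on the disc, with the bounds that the associated
velocity field needs. -/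
structure IsVortexCore (k ℓ ε : ℝ) (c G : ℝ → ℝ) (ψ w : ℝ × ℝ → ℝ) : Prop where
  k_pos : 0 < k
  ℓ_pos : 0 < ℓ
  ε_pos : 0 < ε
  ε_le : ε ≤ 1 / 2
  analyticAt_left : ∀ q ∈ disc ℓ ε, AnalyticAt ℝ c (ψ q)
  analyticAt_right : ∀ q ∈ disc ℓ ε, AnalyticAt ℝ G (ψ q)
  deriv_right : ∀ q ∈ disc ℓ ε, deriv G (ψ q) = -2 * c (ψ q) - 12 * ψ q * deriv c (ψ q)
  compat : ∀ q ∈ disc ℓ ε, 12 * k * ψ q - 2 * c (ψ q) ^ 2 - deriv G (ψ q) * c (ψ q)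
    = -2 * G (ψ q) * deriv c (ψ q)
  hasFDerivAt_psi : ∀ q ∈ disc ℓ ε, HasFDerivAt ψ
    (radialSlope k c (q.1, ψ q) • ContinuousLinearMap.fst ℝ ℝ ℝ
      + w q • ContinuousLinearMap.snd ℝ ℝ ℝ) q
  hasFDerivAt_slope : ∀ q ∈ disc ℓ ε, HasFDerivAt (fun q => radialSlope k c (q.1, ψ q))
    ((3 * k * q.1 ^ 2 + c (ψ q) + q.1 * deriv c (ψ q) * radialSlope k c (q.1, ψ q)) •
        ContinuousLinearMap.fst ℝ ℝ ℝ
      + (q.1 * deriv c (ψ q) * w q) • ContinuousLinearMap.snd ℝ ℝ ℝ) q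
  hasFDerivAt_axial : ∀ q ∈ disc ℓ ε, HasFDerivAt w
    ((q.1 * deriv c (ψ q) * w q) • ContinuousLinearMap.fst ℝ ℝ ℝ
      + axialSecond k c G (q.1, ψ q) • ContinuousLinearMap.snd ℝ ℝ ℝ) q
  sq_eq : ∀ q ∈ disc ℓ ε, w q ^ 2 = axialSq k c G (q.1, ψ q)
  contDiffOn : ContDiffOn ℝ ∞ ψ (disc ℓ ε)
  center : ψ (ℓ, 0) = 0
  pos : ∀ q ∈ disc ℓ ε, q ≠ (ℓ, 0) → 0 < ψ q
  le_right : ∀ q ∈ disc ℓ ε, k * ℓ ^ 2 * ψ q ≤ G (ψ q)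
  boundedLipschitzOn_slope :
    BoundedLipschitzOn (fun q => radialSlope k c (q.1, ψ q)) (disc ℓ ε)
  boundedLipschitzOn_axial : BoundedLipschitzOn w (disc ℓ ε)
  boundedLipschitzOn_psi : BoundedLipschitzOn ψ (disc ℓ ε)
  boundedLipschitzOn_swirl : BoundedLipschitzOn (fun q => √(G (ψ q))) (disc ℓ ε)

/-- The square root of `G ∘ ψ` is Lipschitz, even across the zeros of `ψ`. -/
theorem IsStreamPair.boundedLipschitzOn_sqrt {k δ ℓ : ℝ} {c G : ℝ → ℝ} {N K : Set (ℝ × ℝ)}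
    {ψ w : ℝ × ℝ → ℝ} (h : IsStreamPair k c G δ N ψ w) (hk : 0 < k) (hℓ : 0 < ℓ)
    (hG : ∀ s, |s| < δ → AnalyticAt ℝ G s) (hK : IsCompact K) (hKc : Convex ℝ K) (hKN : K ⊆ N)
    (hr : ∀ q ∈ K, |q.1| ≤ 2 * ℓ) (hψ : ∀ q ∈ K, 0 ≤ ψ q)
    (hle : ∀ q ∈ K, k * ℓ ^ 2 * ψ q ≤ G (ψ q)) :
    BoundedLipschitzOn (fun q => √(G (ψ q))) K := by
  have hψc : ∀ q ∈ K, ContinuousAt ψ q := fun q hq => (h.hasFDerivAt_left q (hKN hq)).continuousAt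
  have hGc : ∀ q ∈ K, ContinuousAt (fun q => G (ψ q)) q := fun q hq =>
    ContinuousAt.comp (f := ψ) (hG _ (h.abs_lt q (hKN hq))).continuousAt (hψc q hq)
  obtain ⟨M, hM⟩ := hK.exists_bound_of_continuousOn (f := fun q => deriv G (ψ q)) fun q hq =>
    (ContinuousAt.comp (f := ψ) (hG _ (h.abs_lt q (hKN hq))).deriv.continuousAt
      (hψc q hq)).continuousWithinAt
  obtain ⟨M', hM'⟩ := hK.exists_bound_of_continuousOn (f := fun q => √(G (ψ q))) fun q hq =>
    (hGc q hq).sqrt.continuousWithinAt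
  refine BoundedLipschitzOn.of_bounds (K := M') (L := 5 * M) hM' fun x hx y hy => ?_
  have hG0 : ∀ q ∈ K, 0 ≤ G (ψ q) := fun q hq =>
    (mul_nonneg (by positivity) (hψ q hq)).trans (hle q hq)
  -- Adding e² makes the root differentiable everywhere on K; the bound does not depend on e, so e →
  -- 0 is harmless.
  have key : ∀ e : ℝ, e ≠ 0 → |√(G (ψ x) + e ^ 2) - √(G (ψ y) + e ^ 2)| ≤ 5 * M * dist x y := by
    intro e he
    have he2 : 0 < e ^ 2 := by positivity
    have hpos : ∀ q ∈ K, 0 < G (ψ q) + e ^ 2 := fun q hq => by linarith [hG0 q hq]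
    rw [dist_eq_norm, ← Real.norm_eq_abs]
    refine hKc.norm_image_sub_le_of_norm_hasFDerivWithin_le
      (f := fun q => √(G (ψ q) + e ^ 2)) (f' := fun q => (1 / (2 * √(G (ψ q) + e ^ 2))) •
        (deriv G (ψ q) • (radialSlope k c (q.1, ψ q) • ContinuousLinearMap.fst ℝ ℝ ℝ
          + w q • ContinuousLinearMap.snd ℝ ℝ ℝ))) (fun q hq => ?_) (fun q hq => ?_) hy hx
    · have h1 := (hG _ (h.abs_lt q (hKN hq))).differentiableAt.hasDerivAt.comp_hasFDerivAt q
        (h.hasFDerivAt_left q (hKN hq))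
      exact ((h1.add_const (e ^ 2)).sqrt (hpos q hq).ne').hasFDerivWithinAt
    · set s := √(G (ψ q) + e ^ 2) with hs
      have hs0 : 0 < s := Real.sqrt_pos.mpr (hpos q hq)
      have hs2 : s ^ 2 = G (ψ q) + e ^ 2 := Real.sq_sqrt (hpos q hq).le
      have hV := h.sq_eq q (hKN hq)
      simp only [axialSq] at hV
      set p := radialSlope k c (q.1, ψ q)
      have hq1 : q.1 ^ 2 ≤ 4 * ℓ ^ 2 := by
        have := pow_le_pow_left₀ (abs_nonneg _) (hr q hq) 2
        rw [sq_abs] at this; linarith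
      have hb : 6 * k * q.1 ^ 2 * ψ q ≤ 24 * G (ψ q) := by
        calc 6 * k * q.1 ^ 2 * ψ q ≤ 6 * k * (4 * ℓ ^ 2) * ψ q := by
              have := hψ q hq
              gcongr
          _ = 24 * (k * ℓ ^ 2 * ψ q) := by ring
          _ ≤ _ := by linarith [hle q hq]
      have hG0' := hG0 q hq
      -- The constraint gives p² + w² = 6kr²ψ - G ≤ 24G ≤ 25s².
      have hp : |p| ≤ 5 * s := abs_le_of_sq_le_sq (by nlinarith) (by positivity)
      have hw : |w q| ≤ 5 * s := abs_le_of_sq_le_sq (by nlinarith) (by positivity)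
      have hM0 := hM q hq
      rw [norm_smul, norm_smul, Real.norm_of_nonneg (by positivity)]
      calc 1 / (2 * s) * (‖deriv G (ψ q)‖ * ‖p • ContinuousLinearMap.fst ℝ ℝ ℝ
              + w q • ContinuousLinearMap.snd ℝ ℝ ℝ‖)
          ≤ 1 / (2 * s) * (M * (5 * s + 5 * s)) := by
            have := (norm_smul_fst_add_smul_snd_le p (w q)).trans (add_le_add hp hw)
            gcongr
            exact (norm_nonneg _).trans hM0
        _ = 5 * M := by field_simp; ring
  have hlim : Tendsto (fun e : ℝ => |√(G (ψ x) + e ^ 2) - √(G (ψ y) + e ^ 2)|) (𝓝[≠] 0)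
      (𝓝 |√(G (ψ x)) - √(G (ψ y))|) := by
    have : Continuous fun e : ℝ => |√(G (ψ x) + e ^ 2) - √(G (ψ y) + e ^ 2)| := by fun_prop
    have := this.tendsto 0
    simp only [ne_eq, OfNat.ofNat_ne_zero, not_false_eq_true, zero_pow, add_zero] at this
    exact this.mono_left nhdsWithin_le_nhds
  refine le_of_tendsto hlim ?_
  filter_upwards [self_mem_nhdsWithin] with e he using key e he

theorem disc_subset_closedBall {ℓ ε : ℝ} (hℓ : 0 < ℓ) (hε : 0 < ε) :
    disc ℓ ε ⊆ Metric.closedBall ((ℓ, 0) : ℝ × ℝ) (ε * ℓ) := by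
  intro q hq
  have hq' : (q.1 - ℓ) ^ 2 + q.2 ^ 2 < ε ^ 2 * ℓ ^ 2 := hq
  have h0 : 0 ≤ ε * ℓ := by positivity
  rw [Metric.mem_closedBall, Prod.dist_eq, Real.dist_eq, Real.dist_eq, max_le_iff]
  constructor <;> refine abs_le_of_sq_le_sq ?_ h0 <;> nlinarith [sq_nonneg q.2, sq_nonneg (q.1 - ℓ)]

theorem isOpen_disc (ℓ ε : ℝ) : IsOpen (disc ℓ ε) :=
  isOpen_lt (by fun_prop) continuous_const

theorem exists_isVortexCore {k ℓ : ℝ} (hk : 0 < k) (hℓ : 0 < ℓ) :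
    ∃ (ε : ℝ) (c G : ℝ → ℝ) (ψ w : ℝ × ℝ → ℝ), IsVortexCore k ℓ ε c G ψ w := by
  obtain ⟨c, G, hp⟩ := exists_isProfilePair hk hℓ
  obtain ⟨δ₀, hδ₀, hδ₀s⟩ := hp.exists_radius
  -- Half of G'(0) = 2kℓ² survives near 0; integrating gives the lower bound on G that controls its
  -- square root.
  have hG' : ∀ᶠ s in 𝓝 0, k * ℓ ^ 2 < deriv G s := by
    refine hp.analyticAt_right.deriv.continuousAt.eventually (lt_mem_nhds ?_)
    rw [hp.deriv_right_zero]
    nlinarith [mul_pos hk (pow_pos hℓ 2)]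
  obtain ⟨δ₁, hδ₁, hδ₁s⟩ := Metric.eventually_nhds_iff.mp hG'
  set δ := min δ₀ δ₁
  have hδ : 0 < δ := lt_min hδ₀ hδ₁
  have hδs := fun s (hs : |s| < δ) => hδ₀s s (hs.trans_le (min_le_left _ _))
  have hGle : ∀ s, |s| < δ → 0 ≤ s → k * ℓ ^ 2 * s ≤ G s := by
    intro s hs hs0
    have hin : ∀ t ∈ Icc 0 s, |t| < δ := fun t ht => by
      rw [abs_of_nonneg ht.1]; rw [abs_of_nonneg hs0] at hs; exact ht.2.trans_lt hs
    have := (convex_Icc 0 s).mul_sub_le_image_sub_of_le_deriv (f := G) (C := k * ℓ ^ 2)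
      (fun t ht => (hδs t (hin t ht)).2.1.continuousAt.continuousWithinAt)
      (fun t ht => (hδs t (hin t (interior_subset ht))).2.1.differentiableAt.differentiableWithinAt)
      (fun t ht => (hδ₁s (by
        simpa using (hin t (interior_subset ht)).trans_le (min_le_right _ _))).le)
      0 (left_mem_Icc.mpr hs0) s (right_mem_Icc.mpr hs0) hs0
    simpa [hp.right_zero] using this
  obtain ⟨η, hη, ψ, w, hψ0, hw0, hst⟩ := exists_isStreamPair hk hℓ hp hδ hδs
  obtain ⟨η', hη', hsub, hpos⟩ := hst.exists_pos hk hℓ (Metric.ball_mem_nhds _ hη) hp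
    (fun s hs => (hδs s hs).1) hψ0 hw0
  -- The bound 1/2 keeps r between ℓ/2 and 2ℓ. The other bound puts the closed square K of half-side
  -- εℓ (a sup-norm ball) inside the region where ψ is controlled; compactness and convexity of K
  -- give the Lipschitz bounds.
  set ε := min (1 / 2) (η' / (2 * ℓ)) with hεdef
  have hε : 0 < ε := lt_min (by norm_num) (by positivity)
  have hεℓ : ε * ℓ < η' := by
    calc ε * ℓ ≤ η' / (2 * ℓ) * ℓ := by gcongr; exact min_le_right _ _
      _ = η' / 2 := by field_simp
      _ < η' := by linarith
  set K := Metric.closedBall ((ℓ, 0) : ℝ × ℝ) (ε * ℓ)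
  have hKc : IsCompact K := isCompact_closedBall _ _
  have hKv : Convex ℝ K := convex_closedBall _ _
  have hKη' : K ⊆ Metric.ball ((ℓ, 0) : ℝ × ℝ) η' := Metric.closedBall_subset_ball hεℓ
  have hKN : K ⊆ Metric.ball ((ℓ, 0) : ℝ × ℝ) η := hKη'.trans hsub
  have hdK : disc ℓ ε ⊆ K := disc_subset_closedBall hℓ hε
  have hψK : ∀ q ∈ K, 0 ≤ ψ q := by
    intro q hq
    rcases eq_or_ne q (ℓ, 0) with rfl | hne
    · exact hψ0.ge
    · exact (hpos q (hKη' hq) hne).le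
  have hleK : ∀ q ∈ K, k * ℓ ^ 2 * ψ q ≤ G (ψ q) := fun q hq =>
    hGle _ (hst.abs_lt q (hKN hq)) (hψK q hq)
  have hrK : ∀ q ∈ K, |q.1| ≤ 2 * ℓ := by
    intro q hq
    have h1 : |q.1 - ℓ| ≤ ε * ℓ := by
      rw [Metric.mem_closedBall, Prod.dist_eq, max_le_iff] at hq
      exact hq.1
    have h2 : ε * ℓ ≤ ℓ := by
      have : ε ≤ 1 := (min_le_left _ _).trans (by norm_num)
      nlinarith
    rw [abs_le] at h1 ⊢
    constructor <;> linarith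
  obtain ⟨hcd, hcdw⟩ := hst.contDiffOn_left_right Metric.isOpen_ball (fun s hs => (hδs s hs).1)
    (fun s hs => (hδs s hs).2.1)
  have hcdU : ContDiffOn ℝ 1 (fun q => radialSlope k c (q.1, ψ q))
      (Metric.ball ((ℓ, 0) : ℝ × ℝ) η) := by
    have h1 : ContDiffOn ℝ 1 (fun q => c (ψ q)) (Metric.ball ((ℓ, 0) : ℝ × ℝ) η) := fun q hq =>
      (hδs _ (hst.abs_lt q hq)).1.contDiffAt.comp_contDiffWithinAt q
        ((hcd.of_le (by simp)) q hq)
    exact contDiffOn_fst.mul ((contDiffOn_const.mul (contDiffOn_fst.pow 2)).add h1)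
  have hb := fun q (hq : q ∈ disc ℓ ε) => hδs _ (hst.abs_lt q (hKN (hdK hq)))
  refine ⟨ε, c, G, ψ, w, ?_⟩
  exact
    { k_pos := hk
      ℓ_pos := hℓ
      ε_pos := hε
      ε_le := min_le_left _ _
      analyticAt_left := fun q hq => (hb q hq).1
      analyticAt_right := fun q hq => (hb q hq).2.1
      deriv_right := fun q hq => (hb q hq).2.2.1
      compat := fun q hq => (hb q hq).2.2.2
      hasFDerivAt_psi := fun q hq => hst.hasFDerivAt_left q (hKN (hdK hq))
      hasFDerivAt_slope := fun q hq =>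
        hst.hasFDerivAt_radialSlope (fun s hs => (hδs s hs).1) (hKN (hdK hq))
      hasFDerivAt_axial := fun q hq => hst.hasFDerivAt_right q (hKN (hdK hq))
      sq_eq := fun q hq => hst.sq_eq q (hKN (hdK hq))
      contDiffOn := hcd.mono (hdK.trans hKN)
      center := hψ0
      pos := fun q hq => hpos q (hKη' (hdK hq))
      le_right := fun q hq => hleK q (hdK hq)
      boundedLipschitzOn_slope :=
        (BoundedLipschitzOn.of_contDiffOn hKv hKc Metric.isOpen_ball hKN hcdU).mono hdK
      boundedLipschitzOn_axial := (BoundedLipschitzOn.of_contDiffOn hKv hKc Metric.isOpen_ball hKN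
        (hcdw.of_le (by simp))).mono hdK
      boundedLipschitzOn_psi := (BoundedLipschitzOn.of_contDiffOn hKv hKc Metric.isOpen_ball hKN
        (hcd.of_le (by simp))).mono hdK
      boundedLipschitzOn_swirl := (hst.boundedLipschitzOn_sqrt hk hℓ (fun s hs => (hδs s hs).2.1)
        hKc hKv hKN hrK hψK hleK).mono hdK }

/-! ### Cylindrical coordinates -/

/-- The `i`-th coordinate as a continuous linear form. -/
abbrev coord (i : Fin 3) : E3 →L[ℝ] ℝ := EuclideanSpace.proj i

theorem cylR_nonneg (x : E3) : 0 ≤ cylR x := Real.sqrt_nonneg _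

theorem cylR_sq (x : E3) : cylR x ^ 2 = x 0 ^ 2 + x 1 ^ 2 := Real.sq_sqrt (by positivity)

theorem sq_add_sq_add_sq_eq_dist (x y : E3) :
    (x 0 - y 0) ^ 2 + (x 1 - y 1) ^ 2 + (x 2 - y 2) ^ 2 = dist x y ^ 2 := by
  rw [EuclideanSpace.dist_eq, Real.sq_sqrt (by positivity)]
  simp [Fin.sum_univ_three, Real.dist_eq, sq_abs]

theorem abs_coord_sub_le_dist (x y : E3) (i : Fin 3) : |x i - y i| ≤ dist x y := by
  have := sq_add_sq_add_sq_eq_dist x y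
  refine abs_le_of_sq_le_sq ?_ dist_nonneg
  fin_cases i <;> simp only [Fin.zero_eta, Fin.mk_one, Fin.reduceFinMk] <;>
    nlinarith [sq_nonneg (x 0 - y 0), sq_nonneg (x 1 - y 1), sq_nonneg (x 2 - y 2)]

theorem abs_cylR_sub_le_dist (x y : E3) : |cylR x - cylR y| ≤ dist x y := by
  have h := sq_add_sq_add_sq_eq_dist x y
  refine abs_le_of_sq_le_sq ?_ dist_nonneg
  have hx := cylR_sq x
  have hy := cylR_sq y
  have hcs : x 0 * y 0 + x 1 * y 1 ≤ cylR x * cylR y := by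
    refine le_of_abs_le (abs_le_of_sq_le_sq ?_ (mul_nonneg (cylR_nonneg x) (cylR_nonneg y)))
    rw [mul_pow, hx, hy]
    nlinarith [sq_nonneg (x 0 * y 1 - x 1 * y 0)]
  nlinarith [sq_nonneg (x 2 - y 2)]

theorem dist_cylRZ_le (x y : E3) : dist (cylRZ x) (cylRZ y) ≤ dist x y := by
  rw [Prod.dist_eq, Real.dist_eq, Real.dist_eq]
  exact max_le (abs_cylR_sub_le_dist x y) (abs_coord_sub_le_dist x y 2)

theorem continuous_cylRZ : Continuous cylRZ :=
  (LipschitzWith.of_dist_le_mul (K := 1) fun x y => by simpa using dist_cylRZ_le x y).continuous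

theorem isOpen_torus (ℓ ε : ℝ) : IsOpen (torus ℓ ε) :=
  (isOpen_disc ℓ ε).preimage continuous_cylRZ

theorem hasFDerivAt_coord (i : Fin 3) (x : E3) : HasFDerivAt (fun x : E3 => x i) (coord i) x :=
  (coord i).hasFDerivAt

theorem hasFDerivAt_cylR {x : E3} (hx : 0 < cylR x) :
    HasFDerivAt cylR ((x 0 / cylR x) • coord 0 + (x 1 / cylR x) • coord 1) x := by
  have h2 : x 0 ^ 2 + x 1 ^ 2 ≠ 0 := by rw [← cylR_sq]; positivity
  have hsq : ∀ i, HasFDerivAt (fun y : E3 => y i ^ 2) ((2 * x i) • coord i) x := fun i => by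
    simp only [sq]
    refine ((hasFDerivAt_coord i x).fun_mul (hasFDerivAt_coord i x)).congr_fderiv ?_
    rw [← add_smul, two_mul]
  have := ((hsq 0).fun_add (hsq 1)).sqrt h2
  refine this.congr_fderiv ?_
  change (1 / (2 * cylR x)) • _ = _
  ext y
  simp
  field_simp

theorem HasFDerivAt.comp_cylRZ {h : ℝ × ℝ → ℝ} {a b : ℝ} {x : E3} (hx : 0 < cylR x)
    (hh : HasFDerivAt h
      (a • ContinuousLinearMap.fst ℝ ℝ ℝ + b • ContinuousLinearMap.snd ℝ ℝ ℝ) (cylRZ x)) :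
    HasFDerivAt (fun x => h (cylRZ x))
      ((a * (x 0 / cylR x)) • coord 0 + (a * (x 1 / cylR x)) • coord 1 + b • coord 2) x := by
  have h1 : HasFDerivAt cylRZ _ x := (hasFDerivAt_cylR hx).prodMk (hasFDerivAt_coord 2 x)
  refine (hh.comp x h1).congr_fderiv ?_
  ext y
  simp
  ring

theorem partialE_eq {v : E3 → E3} {x : E3} {i : Fin 3} {L : E3 →L[ℝ] ℝ}
    (hv : DifferentiableAt ℝ v x) (hL : HasFDerivAt (fun x => v x i) L x) (j : Fin 3) :
    partialE v j i x = L (EuclideanSpace.single j 1) := by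
  have := ((coord i).hasFDerivAt.comp x hv.hasFDerivAt).unique hL
  rw [← this]; rfl

/-- The axisymmetric field `α (x₀ ∂₀ + x₁ ∂₁) + β (x₀ ∂₁ - x₁ ∂₀) + d ∂₂`, where `α`, `β` and `d`
are functions of `(r, z)`. -/
def axisymField (α β d : ℝ × ℝ → ℝ) (x : E3) : E3 :=
  !₂[α (cylRZ x) * x 0 - β (cylRZ x) * x 1, α (cylRZ x) * x 1 + β (cylRZ x) * x 0, d (cylRZ x)]

section axisymField

variable {α β d : ℝ × ℝ → ℝ} {αr αz βr βz dr dz : ℝ} {x : E3}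

theorem hasFDerivAt_axisymField (hx : 0 < cylR x)
    (hα : HasFDerivAt α
      (αr • ContinuousLinearMap.fst ℝ ℝ ℝ + αz • ContinuousLinearMap.snd ℝ ℝ ℝ) (cylRZ x))
    (hβ : HasFDerivAt β
      (βr • ContinuousLinearMap.fst ℝ ℝ ℝ + βz • ContinuousLinearMap.snd ℝ ℝ ℝ) (cylRZ x))
    (hd : HasFDerivAt d
      (dr • ContinuousLinearMap.fst ℝ ℝ ℝ + dz • ContinuousLinearMap.snd ℝ ℝ ℝ) (cylRZ x)) :
    HasFDerivAt (fun x => axisymField α β d x 0)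
      ((α (cylRZ x) + αr * x 0 ^ 2 / cylR x - βr * x 0 * x 1 / cylR x) • coord 0
        + (αr * x 0 * x 1 / cylR x - β (cylRZ x) - βr * x 1 ^ 2 / cylR x) • coord 1
        + (αz * x 0 - βz * x 1) • coord 2) x ∧
    HasFDerivAt (fun x => axisymField α β d x 1)
      ((αr * x 0 * x 1 / cylR x + β (cylRZ x) + βr * x 0 ^ 2 / cylR x) • coord 0
        + (α (cylRZ x) + αr * x 1 ^ 2 / cylR x + βr * x 0 * x 1 / cylR x) • coord 1
        + (αz * x 1 + βz * x 0) • coord 2) x ∧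
    HasFDerivAt (fun x => axisymField α β d x 2)
      ((dr * (x 0 / cylR x)) • coord 0 + (dr * (x 1 / cylR x)) • coord 1 + dz • coord 2) x := by
  have h1 := HasFDerivAt.comp_cylRZ hx hα
  have h2 := HasFDerivAt.comp_cylRZ hx hβ
  have h3 := HasFDerivAt.comp_cylRZ hx hd
  refine ⟨((h1.fun_mul (hasFDerivAt_coord 0 x)).fun_sub
      (h2.fun_mul (hasFDerivAt_coord 1 x))).congr_fderiv ?_,
    ((h1.fun_mul (hasFDerivAt_coord 1 x)).fun_add
      (h2.fun_mul (hasFDerivAt_coord 0 x))).congr_fderiv ?_, h3⟩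
  all_goals
    ext y
    simp
    field_simp
    ring

theorem differentiableAt_axisymField (hx : 0 < cylR x)
    (hα : HasFDerivAt α
      (αr • ContinuousLinearMap.fst ℝ ℝ ℝ + αz • ContinuousLinearMap.snd ℝ ℝ ℝ) (cylRZ x))
    (hβ : HasFDerivAt β
      (βr • ContinuousLinearMap.fst ℝ ℝ ℝ + βz • ContinuousLinearMap.snd ℝ ℝ ℝ) (cylRZ x))
    (hd : HasFDerivAt d
      (dr • ContinuousLinearMap.fst ℝ ℝ ℝ + dz • ContinuousLinearMap.snd ℝ ℝ ℝ) (cylRZ x)) :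
    DifferentiableAt ℝ (axisymField α β d) x := by
  obtain ⟨h0, h1, h2⟩ := hasFDerivAt_axisymField hx hα hβ hd
  rw [differentiableAt_euclidean]
  intro i
  fin_cases i
  exacts [h0.differentiableAt, h1.differentiableAt, h2.differentiableAt]

/-- The steady Euler equations for an axisymmetric field, reduced to the meridional plane. -/
theorem axisymField_euler (hx : 0 < cylR x) {κp κw : ℝ}
    (hα : HasFDerivAt α
      (αr • ContinuousLinearMap.fst ℝ ℝ ℝ + αz • ContinuousLinearMap.snd ℝ ℝ ℝ) (cylRZ x))
    (hβ : HasFDerivAt β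
      (βr • ContinuousLinearMap.fst ℝ ℝ ℝ + βz • ContinuousLinearMap.snd ℝ ℝ ℝ) (cylRZ x))
    (hd : HasFDerivAt d
      (dr • ContinuousLinearMap.fst ℝ ℝ ℝ + dz • ContinuousLinearMap.snd ℝ ℝ ℝ) (cylRZ x))
    {π : ℝ × ℝ → ℝ} (hπ : HasFDerivAt π
      (κp • ContinuousLinearMap.fst ℝ ℝ ℝ + κw • ContinuousLinearMap.snd ℝ ℝ ℝ) (cylRZ x))
    (hdiv : 2 * α (cylRZ x) + cylR x * αr + dz = 0)
    (hr : cylR x * α (cylRZ x) * αr + d (cylRZ x) * αz + α (cylRZ x) ^ 2 - β (cylRZ x) ^ 2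
      + κp / cylR x = 0)
    (hφ : cylR x * α (cylRZ x) * βr + d (cylRZ x) * βz + 2 * α (cylRZ x) * β (cylRZ x) = 0)
    (hz : cylR x * α (cylRZ x) * dr + d (cylRZ x) * dz + κw = 0) :
    divergence (axisymField α β d) x = 0 ∧
    ∀ i, ∑ j, axisymField α β d x j * partialE (axisymField α β d) j i x
      + fderiv ℝ (fun x => π (cylRZ x)) x (EuclideanSpace.single i 1) = 0 := by
  obtain ⟨h0, h1, h2⟩ := hasFDerivAt_axisymField hx hα hβ hd
  have hv := differentiableAt_axisymField hx hα hβ hd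
  have hp := HasFDerivAt.comp_cylRZ hx hπ
  have hR := cylR_sq x
  have e0 : ∀ y, axisymField α β d y 0 = α (cylRZ y) * y 0 - β (cylRZ y) * y 1 := fun _ => rfl
  have e1 : ∀ y, axisymField α β d y 1 = α (cylRZ y) * y 1 + β (cylRZ y) * y 0 := fun _ => rfl
  have e2 : ∀ y, axisymField α β d y 2 = d (cylRZ y) := fun _ => rfl
  -- The only relation between r and the Cartesian coordinates that is needed. Modulo it, the
  -- horizontal components are x₀·(radial) - x₁·(azimuthal) and x₁·(radial) + x₀·(azimuthal).
  have hρ : (cylR x)⁻¹ * (x 0 ^ 2 + x 1 ^ 2) = cylR x := by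
    rw [← hR]; field_simp
  simp only [div_eq_mul_inv] at *
  constructor
  · rw [divergence, Fin.sum_univ_three, partialE_eq hv h0, partialE_eq hv h1, partialE_eq hv h2]
    simp
    linear_combination hdiv + αr * hρ
  · intro i
    have key : ∀ {L : E3 →L[ℝ] ℝ}, HasFDerivAt (fun x => axisymField α β d x i) L x →
        ∑ j, axisymField α β d x j * partialE (axisymField α β d) j i x
          = ∑ j, axisymField α β d x j * L (EuclideanSpace.single j 1) := fun hL =>
      Finset.sum_congr rfl fun j _ => by rw [partialE_eq hv hL]
    rw [hp.fderiv]
    fin_cases i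
    · rw [key h0, Fin.sum_univ_three]
      simp [e0, e1, e2]
      linear_combination x 0 * hr - x 1 * hφ + α (cylRZ x) * (αr * x 0 - βr * x 1) * hρ
    · rw [key h1, Fin.sum_univ_three]
      simp [e0, e1, e2]
      linear_combination x 1 * hr + x 0 * hφ + α (cylRZ x) * (αr * x 1 + βr * x 0) * hρ
    · rw [key h2, Fin.sum_univ_three]
      simp [e0, e1, e2]
      linear_combination hz + dr * α (cylRZ x) * hρ

end axisymField

/-! ### Lipschitz solutions of the Euler equations -/

/-- The `j`-th vector of the standard basis. -/
abbrev basisVec (j : Fin 3) : E3 := EuclideanSpace.single j 1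

theorem IsTest.coord {Ω : Set E3} {Φ : E3 → E3} (h : IsTest Ω Φ) (i : Fin 3) :
    IsTest Ω fun x => Φ x i := by
  obtain ⟨h1, h2, h3⟩ := h
  refine ⟨(GradShafranov.coord i).contDiff.comp h1, ?_, ?_⟩
  · exact h2.comp_left (g := fun y : E3 => y i) rfl
  · exact (tsupport_comp_subset (g := fun y : E3 => y i) rfl Φ).trans h3

theorem IsTest.differentiableAt {V : Type*} [NormedAddCommGroup V] [NormedSpace ℝ V]
    {Ω : Set E3} {Φ : E3 → V} (h : IsTest Ω Φ) (x : E3) : DifferentiableAt ℝ Φ x :=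
  h.1.differentiable (by simp) x

theorem fderiv_coord {v : E3 → E3} {x : E3} (hv : DifferentiableAt ℝ v x) (i j : Fin 3) :
    fderiv ℝ (fun x => v x i) x (basisVec j) = partialE v j i x :=
  (partialE_eq hv ((GradShafranov.coord i).hasFDerivAt.comp x hv.hasFDerivAt).differentiableAt.hasFDerivAt
    j).symm

theorem eq_sum_basisVec (y : E3) : y = ∑ j, y j • basisVec j := by
  ext i
  fin_cases i <;> simp [Fin.sum_univ_three]

theorem fderiv_apply_eq_sum {V : Type*} [NormedAddCommGroup V] [NormedSpace ℝ V] (φ : E3 → V)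
    (x y : E3) : fderiv ℝ φ x y = ∑ j, y j • fderiv ℝ φ x (basisVec j) := by
  conv_lhs => rw [eq_sum_basisVec y]
  simp

/-- Integration by parts against a test function. -/
theorem BoundedLipschitzOn.integral_mul_fderiv {Ω : Set E3} (hΩ : IsOpen Ω) {f φ : E3 → ℝ}
    (hf : BoundedLipschitzOn f Ω) (hd : ∀ᵐ x ∂volume.restrict Ω, DifferentiableAt ℝ f x)
    (hφ : IsTest Ω φ) (v : E3) :
    Integrable (fun x => f x * fderiv ℝ φ x v) (volume.restrict Ω) ∧
    Integrable (fun x => fderiv ℝ f x v * φ x) (volume.restrict Ω) ∧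
    ∫ x in Ω, f x * fderiv ℝ φ x v = -∫ x in Ω, fderiv ℝ f x v * φ x := by
  obtain ⟨K, hK⟩ := hf.lipschitzOnWith
  -- Integration by parts is available for globally Lipschitz functions. The extension agrees with f
  -- on the open set, and the test function and its derivative vanish outside it.
  obtain ⟨g, hg, hgf⟩ := hK.extend_real
  obtain ⟨hφs, hφc, hφt⟩ := hφ
  have hφ1 : ContDiff ℝ 1 φ := hφs.of_le (by simp)
  obtain ⟨D, hD⟩ := hφ1.lipschitzWith_of_hasCompactSupport hφc one_ne_zero
  have hφ0 : ∀ x ∉ Ω, φ x = 0 := fun x hx => image_eq_zero_of_notMem_tsupport fun h => hx (hφt h)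
  have hφ0' : ∀ x ∉ Ω, fderiv ℝ φ x v = 0 := fun x hx => by
    rw [fderiv_of_notMem_tsupport (𝕜 := ℝ) fun h => hx (hφt h)]; rfl
  have e1 : ∀ x ∈ Ω, f x * fderiv ℝ φ x v = g x * fderiv ℝ φ x v := fun x hx => by rw [hgf hx]
  have e2 : ∀ᵐ x ∂volume.restrict Ω, fderiv ℝ f x v * φ x = lineDeriv ℝ g x v * φ x := by
    filter_upwards [hd, ae_restrict_mem hΩ.measurableSet] with x hx hxΩ
    have : f =ᶠ[𝓝 x] g := by
      filter_upwards [hΩ.mem_nhds hxΩ] with y hy using hgf hy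
    rw [this.fderiv_eq, (hx.congr_of_eventuallyEq this.symm).lineDeriv_eq_fderiv]
  have hdc : Continuous fun x => fderiv ℝ φ x v :=
    (hφ1.continuous_fderiv one_ne_zero).clm_apply continuous_const
  have i1 : Integrable fun x => g x * fderiv ℝ φ x v :=
    (hg.continuous.mul hdc).integrable_of_hasCompactSupport
      ((hφc.fderiv_apply ℝ v).mul_left)
  have i2 : Integrable fun x => lineDeriv ℝ g x v * φ x :=
    (hg.locallyIntegrable_lineDeriv v).integrable_smul_right_of_hasCompactSupport
      hφ1.continuous hφc
  refine ⟨(i1.integrableOn).congr ?_, (i2.integrableOn).congr ?_, ?_⟩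
  · filter_upwards [ae_restrict_mem hΩ.measurableSet] with x hx using (e1 x hx).symm
  · filter_upwards [e2] with x hx using hx.symm
  · rw [setIntegral_congr_fun hΩ.measurableSet e1, integral_congr_ae e2,
      setIntegral_eq_integral_of_forall_compl_eq_zero fun x hx => by rw [hφ0' x hx, mul_zero],
      setIntegral_eq_integral_of_forall_compl_eq_zero fun x hx => by rw [hφ0 x hx, mul_zero],
      hg.integral_lineDeriv_mul_eq hD hφc, ← integral_neg]
    refine integral_congr_ae (Eventually.of_forall fun x => ?_)
    simp only
    rw [(hφ1.differentiable one_ne_zero x).lineDeriv_eq_fderiv, map_neg]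
    ring

/-- The integrand is a.e. the derivative of fφ. Each weak equation below is obtained by writing its
integrand a.e. as a sum of such terms. -/
theorem BoundedLipschitzOn.integral_mul_fderiv_add {Ω : Set E3} (hΩ : IsOpen Ω) {f φ : E3 → ℝ}
    (hf : BoundedLipschitzOn f Ω) (hd : ∀ᵐ x ∂volume.restrict Ω, DifferentiableAt ℝ f x)
    (hφ : IsTest Ω φ) (v : E3) :
    Integrable (fun x => f x * fderiv ℝ φ x v + fderiv ℝ f x v * φ x) (volume.restrict Ω) ∧
    ∫ x in Ω, (f x * fderiv ℝ φ x v + fderiv ℝ f x v * φ x) = 0 := by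
  obtain ⟨h1, h2, h3⟩ := hf.integral_mul_fderiv hΩ hd hφ v
  exact ⟨h1.add h2, by rw [integral_add h1 h2, h3, neg_add_cancel]⟩

/-- A bounded Lipschitz velocity and pressure which satisfy the steady incompressible Euler
equations almost everywhere. -/
structure IsLipschitzEuler (u : E3 → E3) (p : E3 → ℝ) (Ω : Set E3) : Prop where
  isOpen : IsOpen Ω
  velocity : ∀ i, BoundedLipschitzOn (fun x => u x i) Ω
  pressure : BoundedLipschitzOn p Ω
  differentiableAt_velocity : ∀ᵐ x ∂volume.restrict Ω, DifferentiableAt ℝ u x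
  differentiableAt_pressure : ∀ᵐ x ∂volume.restrict Ω, DifferentiableAt ℝ p x
  divergence_eq_zero : ∀ᵐ x ∂volume.restrict Ω, divergence u x = 0
  momentum : ∀ᵐ x ∂volume.restrict Ω,
    ∀ i, ∑ j, u x j * partialE u j i x + fderiv ℝ p x (basisVec i) = 0

namespace IsLipschitzEuler

variable {u : E3 → E3} {p : E3 → ℝ} {Ω : Set E3}

theorem differentiableAt_coord (h : IsLipschitzEuler u p Ω) (i : Fin 3) :
    ∀ᵐ x ∂volume.restrict Ω, DifferentiableAt ℝ (fun x => u x i) x := by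
  filter_upwards [h.differentiableAt_velocity] with x hx
  exact (differentiableAt_euclidean.mp hx) i

theorem weaklyDivergenceFree (h : IsLipschitzEuler u p Ω) : WeaklyDivergenceFree u Ω := by
  intro η hη
  have key := fun i => (h.velocity i).integral_mul_fderiv_add h.isOpen (h.differentiableAt_coord i)
    hη (basisVec i)
  have e : ∀ᵐ x ∂volume.restrict Ω, fderiv ℝ η x (u x)
      = ∑ i, (u x i * fderiv ℝ η x (basisVec i)
        + fderiv ℝ (fun x => u x i) x (basisVec i) * η x) := by
    filter_upwards [h.differentiableAt_velocity, h.divergence_eq_zero] with x hx hdiv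
    rw [divergence] at hdiv
    simp only [fderiv_coord hx]
    rw [Finset.sum_add_distrib, ← Finset.sum_mul, hdiv, zero_mul, add_zero,
      fderiv_apply_eq_sum]
    rfl
  rw [integral_congr_ae e, integral_finsetSum _ fun i _ => (key i).1]
  exact Finset.sum_eq_zero fun i _ => (key i).2

/-- The integrand differs from a sum of derivatives of u_i u_j Φ_i and pΦ_i by Φ·(u·∇u + ∇p) + (u·Φ)
div u, which vanishes a.e. -/
theorem weakMomentum (h : IsLipschitzEuler u p Ω) : WeakMomentum u p Ω := by
  intro Φ hΦ
  have hmul : ∀ i j, ∀ᵐ x ∂volume.restrict Ω, DifferentiableAt ℝ (fun x => u x i * u x j) x := by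
    intro i j
    filter_upwards [h.differentiableAt_coord i, h.differentiableAt_coord j] with x hi hj
    exact hi.fun_mul hj
  have k1 := fun i j => ((h.velocity i).mul (h.velocity j)).integral_mul_fderiv_add h.isOpen
    (hmul i j) (hΦ.coord i) (basisVec j)
  have k2 := fun i => h.pressure.integral_mul_fderiv_add h.isOpen h.differentiableAt_pressure
    (hΦ.coord i) (basisVec i)
  have e : ∀ᵐ x ∂volume.restrict Ω,
      inner ℝ (u x) (fderiv ℝ Φ x (u x)) + p x * divergence Φ x
      = ∑ i, (∑ j, (u x i * u x j * fderiv ℝ (fun x => Φ x i) x (basisVec j)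
          + fderiv ℝ (fun x => u x i * u x j) x (basisVec j) * Φ x i)
        + (p x * fderiv ℝ (fun x => Φ x i) x (basisVec i)
          + fderiv ℝ p x (basisVec i) * Φ x i)) := by
    filter_upwards [h.differentiableAt_velocity, h.divergence_eq_zero, h.momentum]
      with x hx hdiv hmom
    have hu := differentiableAt_euclidean.mp hx
    have hprod : ∀ i j l, fderiv ℝ (fun x => u x i * u x j) x (basisVec l)
        = u x i * partialE u l j x + u x j * partialE u l i x := by
      intro i j l
      rw [fderiv_fun_mul (hu i) (hu j), ← fderiv_coord hx, ← fderiv_coord hx]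
      rfl
    have hin : inner ℝ (u x) (fderiv ℝ Φ x (u x)) = ∑ i, ∑ j, u x i * u x j * partialE Φ j i x := by
      rw [PiLp.inner_apply]
      refine Finset.sum_congr rfl fun i _ => ?_
      rw [fderiv_apply_eq_sum]
      simp only [Fin.sum_univ_three, partialE]
      simp
      ring
    have m0 := hmom 0
    have m1 := hmom 1
    have m2 := hmom 2
    rw [hin]
    simp only [fderiv_coord (hΦ.differentiableAt x), hprod, divergence, Fin.sum_univ_three] at *
    linear_combination -(Φ x 0 * m0 + Φ x 1 * m1 + Φ x 2 * m2)
      - (u x 0 * Φ x 0 + u x 1 * Φ x 1 + u x 2 * Φ x 2) * hdiv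
  have i1 := fun i => integrable_finsetSum Finset.univ fun j _ => (k1 i j).1
  rw [integral_congr_ae e, integral_finsetSum _ fun i _ => (i1 i).fun_add (k2 i).1]
  refine Finset.sum_eq_zero fun i _ => ?_
  rw [integral_add (i1 i) (k2 i).1, (k2 i).2, add_zero, integral_finsetSum _ fun j _ => (k1 i j).1]
  exact Finset.sum_eq_zero fun j _ => (k1 i j).2

theorem isWeakEuler (h : IsLipschitzEuler u p Ω) : IsWeakEuler u p Ω :=
  ⟨h.weakMomentum, h.weaklyDivergenceFree⟩

theorem integral_sub_add_sub_add_sub {X : Type*} [MeasurableSpace X] {μ : Measure X}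
    {f₁ f₂ f₃ f₄ f₅ f₆ : X → ℝ} (h₁ : Integrable f₁ μ) (h₂ : Integrable f₂ μ)
    (h₃ : Integrable f₃ μ) (h₄ : Integrable f₄ μ) (h₅ : Integrable f₅ μ) (h₆ : Integrable f₆ μ) :
    ∫ x, (f₁ x - f₂ x) + (f₃ x - f₄ x) + (f₅ x - f₆ x) ∂μ
      = (∫ x, f₁ x ∂μ - ∫ x, f₂ x ∂μ) + (∫ x, f₃ x ∂μ - ∫ x, f₄ x ∂μ)
        + (∫ x, f₅ x ∂μ - ∫ x, f₆ x ∂μ) := by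
  rw [← integral_sub h₁ h₂, ← integral_sub h₃ h₄, ← integral_sub h₅ h₆,
    ← integral_add (h₁.sub' h₂) (h₃.sub' h₄),
    ← integral_add ((h₁.sub' h₂).fun_add (h₃.sub' h₄)) (h₅.sub' h₆)]

theorem isWeakCurl (h : IsLipschitzEuler u p Ω) : IsWeakCurl (curl u) u Ω := by
  intro Φ hΦ
  have key := fun i j l => (h.velocity i).integral_mul_fderiv h.isOpen (h.differentiableAt_coord i)
    (hΦ.coord l) (basisVec j)
  have hΦd := fun x => hΦ.differentiableAt x
  have e1 : ∀ᵐ x ∂volume.restrict Ω, inner ℝ (curl u x) (Φ x)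
      = (fderiv ℝ (fun x => u x 2) x (basisVec 1) * Φ x 0
          - fderiv ℝ (fun x => u x 1) x (basisVec 2) * Φ x 0)
        + (fderiv ℝ (fun x => u x 0) x (basisVec 2) * Φ x 1
          - fderiv ℝ (fun x => u x 2) x (basisVec 0) * Φ x 1)
        + (fderiv ℝ (fun x => u x 1) x (basisVec 0) * Φ x 2
          - fderiv ℝ (fun x => u x 0) x (basisVec 1) * Φ x 2) := by
    filter_upwards [h.differentiableAt_velocity] with x hx
    simp only [fderiv_coord hx]
    rw [PiLp.inner_apply, Fin.sum_univ_three]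
    simp [curl]
    ring
  have e2 : ∀ x, inner ℝ (u x) (curl Φ x)
      = (u x 0 * fderiv ℝ (fun x => Φ x 2) x (basisVec 1)
          - u x 0 * fderiv ℝ (fun x => Φ x 1) x (basisVec 2))
        + (u x 1 * fderiv ℝ (fun x => Φ x 0) x (basisVec 2)
          - u x 1 * fderiv ℝ (fun x => Φ x 2) x (basisVec 0))
        + (u x 2 * fderiv ℝ (fun x => Φ x 1) x (basisVec 0)
          - u x 2 * fderiv ℝ (fun x => Φ x 0) x (basisVec 1)) := by
    intro x
    simp only [fderiv_coord (hΦd x)]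
    rw [PiLp.inner_apply, Fin.sum_univ_three]
    simp [curl]
    ring
  have a := fun i j l => (key i j l).1
  have b := fun i j l => (key i j l).2.1
  have c := fun i j l => (key i j l).2.2
  rw [integral_congr_ae e1, integral_congr_ae (Eventually.of_forall e2)]
  rw [integral_sub_add_sub_add_sub (b 2 1 0) (b 1 2 0) (b 0 2 1) (b 2 0 1) (b 1 0 2) (b 0 1 2),
    integral_sub_add_sub_add_sub (a 0 1 2) (a 0 2 1) (a 1 2 0) (a 1 0 2) (a 2 0 1) (a 2 1 0)]
  rw [c 0 1 2, c 0 2 1, c 1 2 0, c 1 0 2, c 2 0 1, c 2 1 0]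
  ring

theorem norm_le_sum_abs (y : E3) : ‖y‖ ≤ ∑ i, |y i| := by
  conv_lhs => rw [eq_sum_basisVec y]
  refine (norm_sum_le _ _).trans (Finset.sum_le_sum fun i _ => ?_)
  rw [norm_smul]
  simp

theorem exists_holderOnWith (h : IsLipschitzEuler u p Ω) :
    ∃ C γ : ℝ≥0, 0 < γ ∧ γ ≤ 1 ∧ HolderOnWith C γ u Ω := by
  choose K hK using fun i => (h.velocity i).lipschitzOnWith
  refine ⟨∑ i, K i, 1, one_pos, le_rfl, ?_⟩
  rw [holderOnWith_one]
  refine LipschitzOnWith.of_dist_le_mul fun x hx y hy => ?_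
  rw [dist_eq_norm]
  refine (norm_le_sum_abs _).trans ?_
  push_cast
  rw [Finset.sum_mul]
  exact Finset.sum_le_sum fun i _ => (hK i).dist_le_mul x hx y hy

/-- Lipschitz constants bound the partial derivatives wherever u is differentiable. -/
theorem memLp_curl (h : IsLipschitzEuler u p Ω) :
    MemLp (curl u) ⊤ (volume.restrict Ω) := by
  choose K hK using fun i => (h.velocity i).lipschitzOnWith
  have hbd : ∀ i j, ∀ᵐ x ∂volume.restrict Ω, |partialE u j i x| ≤ K i := by
    intro i j
    filter_upwards [h.differentiableAt_velocity, ae_restrict_mem h.isOpen.measurableSet]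
      with x hx hxΩ
    rw [← fderiv_coord hx, ← Real.norm_eq_abs]
    refine (ContinuousLinearMap.le_opNorm _ _).trans ?_
    have := norm_fderiv_le_of_lipschitzOn ℝ (h.isOpen.mem_nhds hxΩ) (hK i)
    simpa using this
  have hmeas : ∀ i j, Measurable (partialE u j i) := fun i j =>
    (GradShafranov.coord i).continuous.measurable.comp (measurable_fderiv_apply_const ℝ u _)
  have hcm : Measurable (curl u) := by
    refine (WithLp.measurable_toLp 2 _).comp (measurable_pi_iff.mpr fun i => ?_)
    fin_cases i
    exacts [(hmeas 2 1).sub (hmeas 1 2), (hmeas 0 2).sub (hmeas 2 0), (hmeas 1 0).sub (hmeas 0 1)]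
  refine memLp_top_of_bound hcm.aestronglyMeasurable (2 * (K 0 + K 1 + K 2) : ℝ) ?_
  filter_upwards [hbd 0 1, hbd 0 2, hbd 1 0, hbd 1 2, hbd 2 0, hbd 2 1] with x b1 b2 b3 b4 b5 b6
  refine (norm_le_sum_abs _).trans ?_
  rw [Fin.sum_univ_three]
  have t0 : |curl u x 0| ≤ _ := abs_sub (partialE u 1 2 x) (partialE u 2 1 x)
  have t1 : |curl u x 1| ≤ _ := abs_sub (partialE u 2 0 x) (partialE u 0 2 x)
  have t2 : |curl u x 2| ≤ _ := abs_sub (partialE u 0 1 x) (partialE u 1 0 x)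
  linarith

theorem gradient_apply (f : E3 → ℝ) (x : E3) (i : Fin 3) :
    gradient f x i = fderiv ℝ f x (basisVec i) := by
  have : inner ℝ (gradient f x) (basisVec i) = fderiv ℝ f x (basisVec i) := by
    rw [gradient, InnerProductSpace.toDual_symm_apply]
  rw [← this]
  generalize gradient f x = y
  simp [EuclideanSpace.inner_single_right]

/-- The momentum equation rewritten by the pointwise identity u·∇u = ω × u + ∇(|u|²/2). -/
theorem lamb (h : IsLipschitzEuler u p Ω) : ∀ᵐ x ∂volume.restrict Ω,
    DifferentiableAt ℝ (fun y => ‖u y‖ ^ 2 / 2 + p y) x ∧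
    cross (curl u x) (u x) + gradient (fun y => ‖u y‖ ^ 2 / 2 + p y) x = 0 := by
  filter_upwards [h.differentiableAt_velocity, h.differentiableAt_pressure, h.momentum]
    with x hx hp hmom
  have hn : HasFDerivAt (fun y => ‖u y‖ ^ 2 / 2 + p y)
      ((2 : ℝ)⁻¹ • (2 • (innerSL ℝ (u x)).comp (fderiv ℝ u x)) + fderiv ℝ p x) x := by
    simp only [div_eq_mul_inv]
    exact (hx.hasFDerivAt.norm_sq.mul_const _).fun_add hp.hasFDerivAt
  refine ⟨hn.differentiableAt, ?_⟩
  have hg : ∀ i, gradient (fun y => ‖u y‖ ^ 2 / 2 + p y) x i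
      = ∑ j, u x j * partialE u i j x + fderiv ℝ p x (basisVec i) := by
    intro i
    rw [gradient_apply, hn.fderiv]
    simp [PiLp.inner_apply, Fin.sum_univ_three, partialE]
    ring
  have m0 := hmom 0
  have m1 := hmom 1
  have m2 := hmom 2
  ext i
  fin_cases i
  all_goals
    simp [hg, cross, crossProduct, curl, Fin.sum_univ_three] at *
    linarith

end IsLipschitzEuler

/-! ### The velocity field of a vortex core -/

namespace IsVortexCore

variable {k ℓ ε : ℝ} {c G : ℝ → ℝ} {ψ w : ℝ × ℝ → ℝ}

theorem half_le (h : IsVortexCore k ℓ ε c G ψ w) {q : ℝ × ℝ} (hq : q ∈ disc ℓ ε) :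
    ℓ / 2 ≤ q.1 := by
  have := disc_subset_closedBall h.ℓ_pos h.ε_pos hq
  rw [Metric.mem_closedBall, Prod.dist_eq, max_le_iff, Real.dist_eq] at this
  have h1 := (abs_le.mp this.1).1
  have h2 := mul_le_mul_of_nonneg_right h.ε_le h.ℓ_pos.le
  linarith

theorem le_two_mul (h : IsVortexCore k ℓ ε c G ψ w) {q : ℝ × ℝ} (hq : q ∈ disc ℓ ε) :
    q.1 ≤ 2 * ℓ := by
  have := disc_subset_closedBall h.ℓ_pos h.ε_pos hq
  rw [Metric.mem_closedBall, Prod.dist_eq, max_le_iff, Real.dist_eq] at this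
  have h1 := (abs_le.mp this.1).2
  have h2 := mul_le_mul_of_nonneg_right h.ε_le h.ℓ_pos.le
  linarith [h.ℓ_pos]

theorem fst_pos (h : IsVortexCore k ℓ ε c G ψ w) {q : ℝ × ℝ} (hq : q ∈ disc ℓ ε) : 0 < q.1 :=
  (half_pos h.ℓ_pos).trans_le (h.half_le hq)

theorem psi_nonneg (h : IsVortexCore k ℓ ε c G ψ w) {q : ℝ × ℝ} (hq : q ∈ disc ℓ ε) :
    0 ≤ ψ q := by
  rcases eq_or_ne q (ℓ, 0) with rfl | hne
  · exact h.center.ge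
  · exact (h.pos q hq hne).le

theorem swirl_sq_nonneg (h : IsVortexCore k ℓ ε c G ψ w) {q : ℝ × ℝ} (hq : q ∈ disc ℓ ε) :
    0 ≤ G (ψ q) :=
  (mul_nonneg (mul_nonneg h.k_pos.le (sq_nonneg ℓ)) (h.psi_nonneg hq)).trans (h.le_right q hq)

theorem _root_.HasFDerivAt.partialR_eq {f : ℝ × ℝ → ℝ} {a b : ℝ} {q : ℝ × ℝ}
    (hf : HasFDerivAt f
      (a • ContinuousLinearMap.fst ℝ ℝ ℝ + b • ContinuousLinearMap.snd ℝ ℝ ℝ) q) :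
    partialR f q = a := by
  have h1 : HasDerivAt (fun r : ℝ => (r, q.2)) (1, 0) q.1 :=
    (hasDerivAt_id q.1).prodMk (hasDerivAt_const _ _)
  have := (HasFDerivAt.comp_hasDerivAt (l := f) (f := fun r : ℝ => (r, q.2)) q.1 hf h1).deriv
  simpa [partialR, Function.comp_def] using this

theorem _root_.HasFDerivAt.partialZ_eq {f : ℝ × ℝ → ℝ} {a b : ℝ} {q : ℝ × ℝ}
    (hf : HasFDerivAt f
      (a • ContinuousLinearMap.fst ℝ ℝ ℝ + b • ContinuousLinearMap.snd ℝ ℝ ℝ) q) :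
    partialZ f q = b := by
  have h1 : HasDerivAt (fun z : ℝ => (q.1, z)) (0, 1) q.2 :=
    (hasDerivAt_const _ _).prodMk (hasDerivAt_id q.2)
  have := (HasFDerivAt.comp_hasDerivAt (l := f) (f := fun z : ℝ => (q.1, z)) q.2 hf h1).deriv
  simpa [partialZ, Function.comp_def] using this

theorem _root_.Filter.EventuallyEq.partialR_eq {f g : ℝ × ℝ → ℝ} {q : ℝ × ℝ} (h : f =ᶠ[𝓝 q] g) :
    partialR f q = partialR g q := by
  have hc : Tendsto (fun r : ℝ => (r, q.2)) (𝓝 q.1) (𝓝 q) :=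
    (show Continuous fun r : ℝ => (r, q.2) by fun_prop).tendsto q.1
  exact Filter.EventuallyEq.deriv_eq
    (show (fun r => f (r, q.2)) =ᶠ[𝓝 q.1] fun r => g (r, q.2) from hc.eventually h)

theorem _root_.Filter.EventuallyEq.partialZ_eq {f g : ℝ × ℝ → ℝ} {q : ℝ × ℝ} (h : f =ᶠ[𝓝 q] g) :
    partialZ f q = partialZ g q := by
  have hc : Tendsto (fun z : ℝ => (q.1, z)) (𝓝 q.2) (𝓝 q) :=
    (show Continuous fun z : ℝ => (q.1, z) by fun_prop).tendsto q.2
  exact Filter.EventuallyEq.deriv_eq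
    (show (fun z => f (q.1, z)) =ᶠ[𝓝 q.2] fun z => g (q.1, z) from hc.eventually h)

theorem partialR_psi (h : IsVortexCore k ℓ ε c G ψ w) {q : ℝ × ℝ} (hq : q ∈ disc ℓ ε) :
    partialR ψ q = radialSlope k c (q.1, ψ q) := (h.hasFDerivAt_psi q hq).partialR_eq

theorem partialZ_psi (h : IsVortexCore k ℓ ε c G ψ w) {q : ℝ × ℝ} (hq : q ∈ disc ℓ ε) :
    partialZ ψ q = w q := (h.hasFDerivAt_psi q hq).partialZ_eq

/-- The terms with c' in ψ_rr and ψ_zz cancel, and the r² terms add up to 3k - k + 3k = 5k. The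
profile identities play no role here. -/
theorem gradShafranov (h : IsVortexCore k ℓ ε c G ψ w) {q : ℝ × ℝ} (hq : q ∈ disc ℓ ε) :
    -gsOperator ψ q = deriv G (ψ q) / 2 + q.1 ^ 2 * (-(5 * k)) := by
  have hn := (isOpen_disc ℓ ε).mem_nhds hq
  have e1 : partialR ψ =ᶠ[𝓝 q] fun q => radialSlope k c (q.1, ψ q) := by
    filter_upwards [hn] with p hp using h.partialR_psi hp
  have e2 : partialZ ψ =ᶠ[𝓝 q] w := by
    filter_upwards [hn] with p hp using h.partialZ_psi hp
  rw [gsOperator, e1.partialR_eq, e2.partialZ_eq, (h.hasFDerivAt_slope q hq).partialR_eq,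
    (h.hasFDerivAt_axial q hq).partialZ_eq, h.partialR_psi hq]
  have := h.fst_pos hq
  simp only [radialSlope, axialSecond]
  field_simp
  ring

theorem localizability (h : IsVortexCore k ℓ ε c G ψ w) {q : ℝ × ℝ} (hq : q ∈ disc ℓ ε) :
    partialR ψ q ^ 2 + partialZ ψ q ^ 2 + √(G (ψ q)) ^ 2 = 2 * q.1 ^ 2 * (3 * k * ψ q) := by
  rw [h.partialR_psi hq, h.partialZ_psi hq, h.sq_eq q hq, Real.sq_sqrt (h.swirl_sq_nonneg hq)]
  simp only [axialSq]
  ring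

theorem velocity_eq (h : IsVortexCore k ℓ ε c G ψ w) {x : E3} (hx : x ∈ torus ℓ ε) :
    velocity ψ (fun s => √(G s)) x
      = axisymField (fun q => w q * (q.1 ^ 2)⁻¹) (fun q => √(G (ψ q)) * (q.1 ^ 2)⁻¹)
          (fun q => -(radialSlope k c (q.1, ψ q) * q.1⁻¹)) x := by
  have hx' : cylRZ x ∈ disc ℓ ε := hx
  have hr : cylR x ≠ 0 := (h.fst_pos hx').ne'
  rw [velocity, h.partialR_psi hx', h.partialZ_psi hx']
  have e : (cylRZ x).1 = cylR x := rfl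
  ext i
  fin_cases i <;> simp [axisymField, eR, ePhi, eZ, e] <;> field_simp
  ring

/-- The one component of the Euler equations that needs the two profile identities, here `hg` and
`hc`; `key` is the equation multiplied by R⁴. -/
theorem radial_momentum {k m R p W f s g g' C C' : ℝ} (hR : R ≠ 0)
    (hp : p = R * (k * R ^ 2 + C)) (hW : W ^ 2 = 6 * k * R ^ 2 * s - g - p ^ 2) (hf : f ^ 2 = g)
    (hg : g' = -2 * C - 12 * s * C')
    (hc : 12 * k * s - 2 * C ^ 2 - g' * C = -2 * g * C') (hm : m = 1 / (2 * k)) :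
    R * (W * (R ^ 2)⁻¹) * (R * C' * W / R ^ 2 - 2 * W / R ^ 3)
      + -(p * R⁻¹) * ((6 * k * R ^ 2 - g' - 2 * p * (R * C')) / 2 / R ^ 2)
      + (W * (R ^ 2)⁻¹) ^ 2 - (f * (R ^ 2)⁻¹) ^ 2 + p / m / R = 0 := by
  have key : R ^ 2 * C' * W ^ 2 - W ^ 2 - f ^ 2 - p * R * (3 * k * R ^ 2 - g' / 2 - p * (R * C'))
      + 2 * k * p * R ^ 3 = 0 := by
    subst hp
    linear_combination (R ^ 2 * C' - 1) * hW - hf + k * R ^ 4 / 2 * hg - R ^ 2 / 2 * hc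
  rw [← zero_div (R ^ 4), ← key, hm]
  field_simp
  ring

/-- The velocity field solves the Euler equations away from the circle `r = ℓ`, `z = 0`. -/
theorem euler_at (h : IsVortexCore k ℓ ε c G ψ w) {m : ℝ} (hm : 2 * k * m = 1) {x : E3}
    (hx : x ∈ torus ℓ ε) (hne : cylRZ x ≠ (ℓ, 0)) :
    DifferentiableAt ℝ (velocity ψ fun s => √(G s)) x ∧
    DifferentiableAt ℝ (fun x => ψ (cylRZ x) / m) x ∧
    divergence (velocity ψ fun s => √(G s)) x = 0 ∧
    ∀ i, ∑ j, velocity ψ (fun s => √(G s)) x j * partialE (velocity ψ fun s => √(G s)) j i x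
      + fderiv ℝ (fun x => ψ (cylRZ x) / m) x (basisVec i) = 0 := by
  have hx' : cylRZ x ∈ disc ℓ ε := hx
  have hr : 0 < (cylRZ x).1 := h.fst_pos hx'
  have hR : 0 < cylR x := hr
  have hev : velocity ψ (fun s => √(G s)) =ᶠ[𝓝 x]
      axisymField (fun q => w q * (q.1 ^ 2)⁻¹) (fun q => √(G (ψ q)) * (q.1 ^ 2)⁻¹)
        (fun q => -(radialSlope k c (q.1, ψ q) * q.1⁻¹)) := by
    filter_upwards [(isOpen_torus ℓ ε).mem_nhds hx] with y hy using h.velocity_eq hy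
  have hψ : 0 < ψ (cylRZ x) := h.pos _ hx' hne
  have hG : 0 < G (ψ (cylRZ x)) :=
    (mul_pos (mul_pos h.k_pos (pow_pos h.ℓ_pos 2)) hψ).trans_le (h.le_right _ hx')
  have hm0 : m ≠ 0 := by rintro rfl; simp at hm
  have hV := h.sq_eq _ hx'
  have hdG := h.deriv_right _ hx'
  have hcomp := h.compat _ hx'
  have dψ := h.hasFDerivAt_psi _ hx'
  have dp := h.hasFDerivAt_slope _ hx'
  have dw := h.hasFDerivAt_axial _ hx'
  have dG := (h.analyticAt_right _ hx').differentiableAt.hasDerivAt.comp_hasFDerivAt _ dψ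
  have df : HasFDerivAt (fun q => √(G (ψ q))) _ (cylRZ x) := dG.sqrt hG.ne'
  have dr : HasFDerivAt (fun q : ℝ × ℝ => q.1) (ContinuousLinearMap.fst ℝ ℝ ℝ) (cylRZ x) :=
    hasFDerivAt_fst
  have hf0 : 0 < √(G (ψ (cylRZ x))) := Real.sqrt_pos.mpr hG
  have hf2 : √(G (ψ (cylRZ x))) ^ 2 = G (ψ (cylRZ x)) := Real.sq_sqrt hG.le
  have e1 : (cylRZ x).1 = cylR x := rfl
  simp only [axialSq, radialSlope, e1] at hV
  have hinv2 : HasDerivAt (fun t : ℝ => (t ^ 2)⁻¹) (-2 * (cylR x ^ 3)⁻¹) (cylRZ x).1 := by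
    have h2 : HasDerivAt (fun t : ℝ => t ^ 2) _ (cylRZ x).1 := hasDerivAt_pow 2 _
    refine (h2.fun_inv (pow_ne_zero 2 hr.ne')).congr_deriv ?_
    rw [e1]; field_simp; norm_num [mul_comm]
  have hinv1 : HasDerivAt (fun t : ℝ => t⁻¹) (-(cylR x ^ 2)⁻¹) (cylRZ x).1 := hasDerivAt_inv hr.ne'
  have di2 : HasFDerivAt (fun q : ℝ × ℝ => (q.1 ^ 2)⁻¹) _ (cylRZ x) :=
    hinv2.comp_hasFDerivAt _ dr
  have di1 : HasFDerivAt (fun q : ℝ × ℝ => q.1⁻¹) _ (cylRZ x) := hinv1.comp_hasFDerivAt _ dr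
  set q := cylRZ x with hq
  set p := radialSlope k c (q.1, ψ q) with hp
  set f := √(G (ψ q)) with hf
  have hα : HasFDerivAt (fun q : ℝ × ℝ => w q * (q.1 ^ 2)⁻¹)
      ((q.1 * deriv c (ψ q) * w q / cylR x ^ 2 - 2 * w q / cylR x ^ 3) •
          ContinuousLinearMap.fst ℝ ℝ ℝ
        + (axialSecond k c G (q.1, ψ q) / cylR x ^ 2) • ContinuousLinearMap.snd ℝ ℝ ℝ) q := by
    refine (dw.fun_mul di2).congr_fderiv ?_
    ext <;> simp [e1] <;> field_simp <;> ring
  have hβ : HasFDerivAt (fun q : ℝ × ℝ => √(G (ψ q)) * (q.1 ^ 2)⁻¹)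
      ((deriv G (ψ q) * p / (2 * f) / cylR x ^ 2 - 2 * f / cylR x ^ 3) •
          ContinuousLinearMap.fst ℝ ℝ ℝ
        + (deriv G (ψ q) * w q / (2 * f) / cylR x ^ 2) • ContinuousLinearMap.snd ℝ ℝ ℝ) q := by
    refine (df.fun_mul di2).congr_fderiv ?_
    ext <;> simp [e1] <;> field_simp <;> ring
  have hd : HasFDerivAt (fun q : ℝ × ℝ => -(radialSlope k c (q.1, ψ q) * q.1⁻¹))
      ((-(3 * k * q.1 ^ 2 + c (ψ q) + q.1 * deriv c (ψ q) * p) / cylR x + p / cylR x ^ 2) •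
          ContinuousLinearMap.fst ℝ ℝ ℝ
        + (-(q.1 * deriv c (ψ q) * w q) / cylR x) • ContinuousLinearMap.snd ℝ ℝ ℝ) q := by
    refine ((dp.fun_mul di1).fun_neg).congr_fderiv ?_
    ext <;> simp [e1, hp] <;> field_simp <;> ring
  have hπ : HasFDerivAt (fun q : ℝ × ℝ => ψ q / m)
      ((p / m) • ContinuousLinearMap.fst ℝ ℝ ℝ + (w q / m) • ContinuousLinearMap.snd ℝ ℝ ℝ) q := by
    simp only [div_eq_mul_inv]
    refine (dψ.mul_const _).congr_fderiv ?_
    ext <;> simp <;> ring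
  have hmk : m = 1 / (2 * k) := by
    have := h.k_pos
    field_simp; linarith
  have hk := h.k_pos
  have hpR : p = cylR x * (k * cylR x ^ 2 + c (ψ q)) := by rw [hp, radialSlope, e1]
  have hpe : radialSlope k c (cylR x, ψ q) = p := by rw [hp, e1]
  have hradial := hV
  rw [← hpR] at hradial
  obtain ⟨hdiv, heul⟩ := axisymField_euler hR hα hβ hd hπ
    (by simp only [← hq, e1]; field_simp; ring)
    (by
      simp only [← hq, ← hf, e1, axialSecond, hpe]
      rw [radial_momentum hR.ne' hpR hradial hf2 hdG hcomp hmk])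
    -- Azimuthal component: r u_φ = √G(ψ) depends on ψ alone, hence is constant along the flow.
    (by simp only [← hq, ← hf, e1, hpe]; field_simp; ring)
    (by
      simp only [← hq, e1, hpe]
      rw [hmk, hpR]
      field_simp
      ring)
  refine ⟨(differentiableAt_axisymField hR hα hβ hd).congr_of_eventuallyEq hev,
    (HasFDerivAt.comp_cylRZ hR hπ).differentiableAt, ?_, ?_⟩
  · simp only [divergence, partialE, hev.fderiv_eq] at hdiv ⊢
    exact hdiv
  · simp only [partialE, hev.fderiv_eq, hev.self_of_nhds] at heul ⊢
    exact heul

theorem boundedLipschitzOn_cylR (h : IsVortexCore k ℓ ε c G ψ w) :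
    BoundedLipschitzOn cylR (torus ℓ ε) :=
  .of_bounds (K := 2 * ℓ) (L := 1)
    (fun x hx => by
      rw [abs_of_nonneg (cylR_nonneg x)]
      exact h.le_two_mul (q := cylRZ x) hx)
    fun x _ y _ => by simpa using abs_cylR_sub_le_dist x y

theorem boundedLipschitzOn_horizontal (h : IsVortexCore k ℓ ε c G ψ w) {i : Fin 3} (hi : i ≠ 2) :
    BoundedLipschitzOn (fun x : E3 => x i) (torus ℓ ε) := by
  refine .of_bounds (K := 2 * ℓ) (L := 1) (fun x hx => ?_)
    fun x _ y _ => by simpa using abs_coord_sub_le_dist x y i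
  refine le_trans ?_ (h.le_two_mul (q := cylRZ x) hx)
  refine abs_le_of_sq_le_sq ?_ (cylR_nonneg x)
  change x i ^ 2 ≤ cylR x ^ 2
  rw [cylR_sq]
  fin_cases i
  · simpa using sq_nonneg (x 1)
  · simpa using sq_nonneg (x 0)
  · exact absurd rfl hi

theorem boundedLipschitzOn_velocity (h : IsVortexCore k ℓ ε c G ψ w) (i : Fin 3) :
    BoundedLipschitzOn (fun x => velocity ψ (fun s => √(G s)) x i) (torus ℓ ε) := by
  have lift : ∀ {f : ℝ × ℝ → ℝ}, BoundedLipschitzOn f (disc ℓ ε) →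
      BoundedLipschitzOn (fun x => f (cylRZ x)) (torus ℓ ε) := fun hf =>
    hf.comp (L := 1) (fun x _ y _ => by simpa using dist_cylRZ_le x y) fun x hx => hx
  have hinv := h.boundedLipschitzOn_cylR.inv_of_le (half_pos h.ℓ_pos)
    fun x hx => h.half_le (q := cylRZ x) hx
  have hinv2 : BoundedLipschitzOn (fun x => (cylR x ^ 2)⁻¹) (torus ℓ ε) :=
    (hinv.mul hinv).congr fun x _ => by rw [sq, mul_inv]
  have hα := (lift h.boundedLipschitzOn_axial).mul hinv2
  have hβ := (lift h.boundedLipschitzOn_swirl).mul hinv2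
  have hd := ((lift h.boundedLipschitzOn_slope).mul hinv).neg
  have h0 := h.boundedLipschitzOn_horizontal (i := 0) (by decide)
  have h1 := h.boundedLipschitzOn_horizontal (i := 1) (by decide)
  fin_cases i
  · exact ((hα.mul h0).sub (hβ.mul h1)).congr fun x hx => by rw [h.velocity_eq hx]; rfl
  · exact ((hα.mul h1).add (hβ.mul h0)).congr fun x hx => by rw [h.velocity_eq hx]; rfl
  · exact hd.congr fun x hx => by rw [h.velocity_eq hx]; rfl

/-- The exceptional circle r = ℓ, z = 0 lies in this proper subspace, so it is null. -/
theorem volume_plane_eq_zero : volume {x : E3 | x 2 = 0} = 0 := by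
  have := Measure.addHaar_submodule (volume : Measure E3) (LinearMap.ker (coord 2).toLinearMap) ?_
  · exact this
  · intro htop
    have : EuclideanSpace.single 2 (1 : ℝ) ∈ LinearMap.ker (coord 2).toLinearMap := by simp [htop]
    simp at this

theorem isLipschitzEuler (h : IsVortexCore k ℓ ε c G ψ w) {m : ℝ} (hm : 2 * k * m = 1) :
    IsLipschitzEuler (velocity ψ fun s => √(G s)) (fun x => ψ (cylRZ x) / m) (torus ℓ ε) := by
  have key : ∀ᵐ x ∂volume.restrict (torus ℓ ε), x ∈ torus ℓ ε ∧ cylRZ x ≠ (ℓ, 0) := by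
    have hne : ∀ᵐ x : E3, x 2 ≠ 0 := measure_eq_zero_iff_ae_notMem.mp volume_plane_eq_zero
    filter_upwards [ae_restrict_mem (isOpen_torus ℓ ε).measurableSet, ae_restrict_of_ae hne]
      with x hx hx2
    exact ⟨hx, fun e => hx2 (congrArg Prod.snd e)⟩
  have hψ : BoundedLipschitzOn (fun x => ψ (cylRZ x)) (torus ℓ ε) :=
    h.boundedLipschitzOn_psi.comp (L := 1) (fun x _ y _ => by simpa using dist_cylRZ_le x y)
      fun x hx => hx
  exact
    { isOpen := isOpen_torus ℓ ε
      velocity := h.boundedLipschitzOn_velocity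
      pressure := (hψ.mul (.const m⁻¹)).congr fun x _ => div_eq_mul_inv _ _
      differentiableAt_velocity := key.mono fun x hx => (h.euler_at hm hx.1 hx.2).1
      differentiableAt_pressure := key.mono fun x hx => (h.euler_at hm hx.1 hx.2).2.1
      divergence_eq_zero := key.mono fun x hx => (h.euler_at hm hx.1 hx.2).2.2.1
      momentum := key.mono fun x hx => (h.euler_at hm hx.1 hx.2).2.2.2 }

end IsVortexCore

end GradShafranov

end

theorem theorem3p1 (ℓ τ : ℝ) (hℓ : 0 < ℓ) (hτ : 0 < τ) :
    ∃ (ε : ℝ) (ψ : ℝ × ℝ → ℝ) (A P G F : ℝ → ℝ),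
      0 < ε ∧ ε < 1 ∧
      -- the stream function: smooth, with a strict minimum, of value zero, at the centre
      ContDiffOn ℝ ∞ ψ (GradShafranov.disc ℓ ε) ∧
      ψ (ℓ, 0) = 0 ∧
      (∀ q ∈ GradShafranov.disc ℓ ε, q ≠ (ℓ, 0) → 0 < ψ q) ∧
      -- `A`, `P` and `F ^ 2` (which is `G`) are real analytic on the range of `ψ`
      AnalyticOnNhd ℝ A (ψ '' GradShafranov.disc ℓ ε) ∧
      AnalyticOnNhd ℝ P (ψ '' GradShafranov.disc ℓ ε) ∧
      AnalyticOnNhd ℝ G (ψ '' GradShafranov.disc ℓ ε) ∧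
      (∀ s ∈ ψ '' GradShafranov.disc ℓ ε, F s ^ 2 = G s) ∧
      -- the Grad-Shafranov equation, pointwise
      (∀ q ∈ GradShafranov.disc ℓ ε,
        -GradShafranov.gsOperator ψ q = deriv G (ψ q) / 2 + q.1 ^ 2 * deriv P (ψ q)) ∧
      -- the localizability constraint
      (∀ q ∈ GradShafranov.disc ℓ ε,
        GradShafranov.partialR ψ q ^ 2 + GradShafranov.partialZ ψ q ^ 2 + F (ψ q) ^ 2
          = 2 * q.1 ^ 2 * A (ψ q)) ∧
      -- the pressure `-P(ψ) - A(ψ)` is `ψ / (ℓ τ)`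
      (∀ q ∈ GradShafranov.disc ℓ ε, -P (ψ q) - A (ψ q) = ψ q / (ℓ * τ)) ∧
      -- the velocity is Hölder continuous
      (∃ C γ : ℝ≥0, 0 < γ ∧ γ ≤ 1 ∧
        HolderOnWith C γ (GradShafranov.velocity ψ F) (GradShafranov.torus ℓ ε)) ∧
      -- the steady Euler equations hold weakly
      GradShafranov.IsWeakEuler (GradShafranov.velocity ψ F)
        (fun x => ψ (GradShafranov.cylRZ x) / (ℓ * τ)) (GradShafranov.torus ℓ ε) ∧
      -- the vorticity exists almost everywhere, is the weak curl, and is bounded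
      (∀ᵐ x ∂(volume.restrict (GradShafranov.torus ℓ ε)),
        DifferentiableAt ℝ (GradShafranov.velocity ψ F) x) ∧
      GradShafranov.IsWeakCurl (GradShafranov.curl (GradShafranov.velocity ψ F))
        (GradShafranov.velocity ψ F) (GradShafranov.torus ℓ ε) ∧
      MemLp (GradShafranov.curl (GradShafranov.velocity ψ F)) ⊤
        (volume.restrict (GradShafranov.torus ℓ ε)) ∧
      -- `ω × u + ∇ (|u|² / 2 + p) = 0` almost everywhere
      (∀ᵐ x ∂(volume.restrict (GradShafranov.torus ℓ ε)),
        DifferentiableAt ℝ (fun y => ‖GradShafranov.velocity ψ F y‖ ^ 2 / 2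
          + ψ (GradShafranov.cylRZ y) / (ℓ * τ)) x ∧
        GradShafranov.cross (GradShafranov.curl (GradShafranov.velocity ψ F) x)
            (GradShafranov.velocity ψ F x)
          + gradient (fun y => ‖GradShafranov.velocity ψ F y‖ ^ 2 / 2
              + ψ (GradShafranov.cylRZ y) / (ℓ * τ)) x = 0) := by
  have hm0 : (0 : ℝ) < ℓ * τ := mul_pos hℓ hτ
  obtain ⟨ε, c, G, ψ, w, h⟩ :=
    -- Chosen so that the pressure 2kψ equals ψ/(ℓτ).
    GradShafranov.exists_isVortexCore (k := 1 / (2 * (ℓ * τ))) (by positivity) hℓ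
  have hm : 2 * (1 / (2 * (ℓ * τ))) * (ℓ * τ) = 1 := by field_simp
  have hE := h.isLipschitzEuler hm
  set k := 1 / (2 * (ℓ * τ))
  -- The factor 3k comes from the 6kr²ψ in `axialSq`, and -5k from the r² terms of the
  -- Grad–Shafranov operator; together -P - A = 2ks.
  refine ⟨ε, ψ, fun s => 3 * k * s, fun s => -(5 * k) * s, G, fun s => √(G s), h.ε_pos,
    h.ε_le.trans_lt one_half_lt_one, h.contDiffOn, h.center, h.pos,
    fun _ _ => analyticAt_const.mul analyticAt_id, fun _ _ => analyticAt_const.mul analyticAt_id,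
    ?_, ?_, fun q hq => ?_, fun q hq => h.localizability hq, fun q _ => ?_,
    hE.exists_holderOnWith, hE.isWeakEuler, hE.differentiableAt_velocity, hE.isWeakCurl,
    hE.memLp_curl, hE.lamb⟩
  · rintro _ ⟨q, hq, rfl⟩
    exact h.analyticAt_right q hq
  · rintro _ ⟨q, hq, rfl⟩
    exact Real.sq_sqrt (h.swirl_sq_nonneg hq)
  · rw [h.gradShafranov hq, deriv_const_mul_id]
  · rw [eq_div_iff hm0.ne']
    linear_combination ψ q * hm
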